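/- Let $p$ be a prime, $k\ge 1$, and let $a,b\in[1,p-1]$ be primitive roots modulo $p$ with $ab\equiv 1 \pmod p$. Permutations act on the right, $g^h=h^{-1}gh$, and $[x,y]$ denotes an interval of integers. **Groups.** Identify $[1,p^k]$ with $p$ consecutive blocks of length $p^{k-1}$, so that $S_{p^{k-1}}\wr S_p\le S_{p^k}$, with elements $(f_1,\dots,f_p;\delta)$. Put $\gamma=(1,2,\dots,p)$, and let $\sigma_1^{(1)}$ be the permutation $i\mapsto ai \pmod p$ of $[1,p]$ (fixing $p$), with inverse $\tau\colon i\mapsto bi \pmod p$; extend $\tau$ to $[0,p]$ by $(0)\tau=0$. Define recursively $g_k^{(k)}=(1,\dots,1;\gamma)$ and $g_j^{(k)}=(g_j^{(k-1)},1,\dots,1;1)$ for $j<k$, and let $P_{p^k}=\langle g_1^{(k)},\dots,g_k^{(k)}\rangle=P_{p^{k-1}}\wr P_p$ (with $P_1=1$), a Sylow $p$-subgroup of $S_{p^k}$ with normalizer $N_{p^k}$. Define $\sigma_k^{(k)}=(1,\dots,1;\sigma_1^{(1)})$ (which permutes the blocks) and $\sigma_j^{(k)}=(\sigma_j^{(k-1)},\dots,\sigma_j^{(k-1)};1)$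 for $1\le j<k$; these lie in $N_{p^k}$. The group $N_{p^k}$ acts on the set $\mathrm{Irr}(P_{p^k})$ of complex irreducible characters by $\theta^h(g)=\theta(hgh^{-1})$. **Tree functions.** A labeling function of height $k$ assigns a label in $[0,p]$ to each sequence of length less than $k$ with symbols in $[1,p]$ (the vertices of the complete $p$-ary rooted tree with $k$ levels). Two labeling functions are equivalent if one is obtained from the other by permuting cyclically, by powers of $\gamma$, the $p$ subtrees below each non-leaf vertex; the classes are the $p^k$-tree functions. Write $(T_1\mid\dots\mid T_p;x)$ for the tree function with root label $x$ and the $p^{k-1}$-tree functions $T_1,\dots,T_p$ as the subfunctions below the root. A tree function is admissible if no leaf has label $p$ and, at every other vertex, the $p$ tree subfunctions below it are all equal if its label is in $[0,p-1]$, and not all equal if its label is $p$. **Correspondence.** Let $\varphi_\varepsilon$ be the linear character of $P_p=\langle\gamma\rangle$ with $\varphi_\varepsilon(\gamma)=e^{2\pi i\varepsilon/p}$. For $\varphi\in\mathrm{Irr}(P_{p^{k-1}})$ afforded by $V$ and $\varepsilon\in[0,p-1]$, let $\mathcal X(\varphi;\varepsilon)$ be the product of the character of the natural extension of $V^{\otimes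 p}$ to $P_{p^{k-1}}\wr P_p$ with the inflation of $\varphi_\varepsilon$. To $\theta\in\mathrm{Irr}(P_{p^k})$ one associates recursively a $p^k$-tree function $\mathcal T(\theta)$: the empty one if $k=0$; $(\mathcal T(\varphi)\mid\dots\mid\mathcal T(\varphi);\varepsilon)$ if $\theta=\mathcal X(\varphi;\varepsilon)$; and $(\mathcal T(\theta_1)\mid\dots\mid\mathcal T(\theta_p);p)$ if $\theta$ is induced from the character $\theta_1\times\dots\times\theta_p$ of $(P_{p^{k-1}})^{p}$ with $\theta_1,\dots,\theta_p\in\mathrm{Irr}(P_{p^{k-1}})$ not all equal. In particular $\mathcal T(\varphi_\varepsilon)$ is the single vertex labelled $\varepsilon$. The group $N_{p^k}$ acts on the tree functions of irreducible characters by $\mathcal T(\theta)^h=\mathcal T(\theta^h)$, which is well defined. **Theorem.** Let $\theta\in\mathrm{Irr}(P_{p^k})$ and write $\mathcal T(\theta)=(\mathcal T_1\mid\dots\mid\mathcal T_p;x)$. Then $\mathcal T(\theta)$ and $\mathcal T_1,\dots,\mathcal T_p$ are admissible, and for $j\in[1,k]$ $$\mathcal T(\theta)^{\sigma_j^{(k)}}=\begin{cases}(\mathcal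 T_1^{\sigma_j^{(k-1)}}\mid\dots\mid\mathcal T_p^{\sigma_j^{(k-1)}};\,x) & \text{if } j<k,\\[2pt] (\mathcal T_{(1)\tau}\mid\dots\mid\mathcal T_{(p)\tau};\,(x)\tau) & \text{if } j=k.\end{cases}$$ -/

import Mathlib

open scoped TensorProduct

namespace SylowTree

/-! ### Permutations of `[1, p ^ k]`

The set `[1, n]` is `Fin n`, with `i : Fin n` standing for the number `i + 1`. Permutations compose
as functions (from right to left). Conjugation `g ^ h`, written as `h⁻¹ g h` when permutations act
on the right, is therefore `h * g * h⁻¹` here. -/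

/-- The `p`-cycle `γ = (1, 2, …, p)`. -/
def rot (p : ℕ) [NeZero p] : Equiv.Perm (Fin p) := Equiv.addRight 1

/-- The bijection of `[1, p]` with the residues modulo `p`; the number `i + 1` is sent to its
class. -/
def residue (p : ℕ) [NeZero p] : Fin p ≃ ZMod p :=
  (ZMod.finEquiv p).toEquiv.trans (Equiv.addRight 1)

/-- The permutation `σ₁⁽¹⁾` of `[1, p]`, which is `i ↦ a i` modulo `p` (and fixes `p`). If `a` is a
primitive root modulo `p`, this is the cycle `(a₁, …, a_{p-1})` with `a_i ≡ a ^ i`. -/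
def sigmaOne {p : ℕ} [NeZero p] (a : (ZMod p)ˣ) : Equiv.Perm (Fin p) :=
  (residue p).symm.permCongr a.mulLeft

/-- `τ = (σ₁⁽¹⁾)⁻¹` as a permutation of `[1, p]`. -/
def tau {p : ℕ} [NeZero p] (a : (ZMod p)ˣ) : Equiv.Perm (Fin p) := (sigmaOne a)⁻¹

/-- `τ` extended to `[0, p]` by `0 ↦ 0`. Here `x : Fin (p + 1)` stands for the number `x` itself, so
that `i : Fin p`, which stands for `i + 1 ∈ [1, p]`, becomes `i.succ`. -/
def tauLabel {p : ℕ} [NeZero p] (a : (ZMod p)ˣ) (x : Fin (p + 1)) : Fin (p + 1) :=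
  Fin.cases 0 (fun i => (tau a i).succ) x

/-- `[1, p ^ (k + 1)]` consists of `p` consecutive blocks of length `p ^ k`: the pair `(m, r)` is
the `r`-th point of the `m`-th block, that is, the point `m * p ^ k + r`, counted from `0`. -/
def blockEquiv (p k : ℕ) : Fin p × Fin (p ^ k) ≃ Fin (p ^ (k + 1)) :=
  finProdFinEquiv.trans (finCongr (pow_succ' p k).symm)

/-- The element `(f₁, …, f_p; δ)` of the wreath product `S_{p ^ k} ≀ S_p`, as a permutation of
`[1, p ^ (k + 1)]`: the `r`-th point of block `m` is sent to the point `f_{δ(m)}(r)` of block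
`δ(m)`. -/
def wr {p k : ℕ} (f : Fin p → Equiv.Perm (Fin (p ^ k))) (δ : Equiv.Perm (Fin p)) :
    Equiv.Perm (Fin (p ^ (k + 1))) :=
  (blockEquiv p k).permCongr (Equiv.prodShear δ fun m => f (δ m))

/-- The permutations `g_1⁽ᵏ⁾, …, g_k⁽ᵏ⁾` of `[1, p ^ k]`; the index `j : Fin k` stands for `j + 1`.
The last one permutes the `p` blocks cyclically, `g_k⁽ᵏ⁾ = (1, …, 1; γ)`, and
`g_j⁽ᵏ⁾ = (g_j⁽ᵏ⁻¹⁾, 1, …, 1; 1)` for `j < k`. -/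
def gen (p : ℕ) [NeZero p] : (k : ℕ) → Fin k → Equiv.Perm (Fin (p ^ k))
  | 0 => Fin.elim0
  | k + 1 => Fin.lastCases (wr 1 (rot p)) fun j => wr (Pi.mulSingle 0 (gen p k j)) 1

/-- The Sylow `p`-subgroup `P_{p ^ k} = ⟨g_1⁽ᵏ⁾, …, g_k⁽ᵏ⁾⟩` of `S_{p ^ k}`. -/
def Syl (p : ℕ) [NeZero p] (k : ℕ) : Subgroup (Equiv.Perm (Fin (p ^ k))) :=
  Subgroup.closure (Set.range (gen p k))

/-- The permutations `σ_1⁽ᵏ⁾, …, σ_k⁽ᵏ⁾` of `[1, p ^ k]`; the index `j : Fin k` stands for `j + 1`.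
For `j < k`, `σ_j⁽ᵏ⁾` is the product of the `p` translates of `σ_j⁽ᵏ⁻¹⁾`, one in each block.
The permutation `σ_k⁽ᵏ⁾` permutes the `p` blocks according to `σ₁⁽¹⁾` and keeps the position inside
the block; it is the product of the cycles `(a₁ p ^ (k-1) - i, …, a_{p-1} p ^ (k-1) - i)` over
`0 ≤ i < p ^ (k - 1)`. -/
def sigma {p : ℕ} [NeZero p] (a : (ZMod p)ˣ) : (k : ℕ) → Fin k → Equiv.Perm (Fin (p ^ k))
  | 0 => Fin.elim0
  | k + 1 => Fin.lastCases (wr 1 (sigmaOne a)) fun j => wr (fun _ => sigma a k j) 1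

section facts

theorem wr_mul {p k : ℕ} (f f' : Fin p → Equiv.Perm (Fin (p ^ k))) (δ δ' : Equiv.Perm (Fin p)) :
    wr f δ * wr f' δ' = wr (fun m => f m * f' (δ⁻¹ m)) (δ * δ') := by
  ext x
  simp [wr, Equiv.permCongr_apply, Equiv.prodShear]

theorem wr_one {p k : ℕ} : wr (1 : Fin p → Equiv.Perm (Fin (p ^ k))) 1 = 1 := by
  ext x
  simp [wr, Equiv.permCongr_apply, Equiv.prodShear]

variable {p : ℕ} [NeZero p] {k : ℕ}

/-- The embedding of the base group `(S_{p ^ k}) ^ p`. -/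
def wrBase (p k : ℕ) [NeZero p] :
    (Fin p → Equiv.Perm (Fin (p ^ k))) →* Equiv.Perm (Fin (p ^ (k + 1))) where
  toFun f := wr f 1
  map_one' := wr_one
  map_mul' f f' := by rw [wr_mul]; rfl

/-- The embedding of the top group `S_p`. -/
def wrTop (p k : ℕ) [NeZero p] : Equiv.Perm (Fin p) →* Equiv.Perm (Fin (p ^ (k + 1))) where
  toFun δ := wr 1 δ
  map_one' := wr_one
  map_mul' δ δ' := by rw [wr_mul]; congr 1

theorem wrBase_apply (f : Fin p → Equiv.Perm (Fin (p ^ k))) : wrBase p k f = wr f 1 := rfl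

theorem wrTop_apply (δ : Equiv.Perm (Fin p)) : wrTop p k δ = wr 1 δ := rfl

theorem wr_eq (f : Fin p → Equiv.Perm (Fin (p ^ k))) (δ : Equiv.Perm (Fin p)) :
    wr f δ = wrBase p k f * wrTop p k δ := by
  rw [wrBase_apply, wrTop_apply, wr_mul]
  simp

theorem wr_conj (h : Fin p → Equiv.Perm (Fin (p ^ k))) (δ : Equiv.Perm (Fin p)) :
    wrTop p k δ * wrBase p k h * (wrTop p k δ)⁻¹ = wrBase p k (fun m => h (δ⁻¹ m)) := by
  rw [mul_inv_eq_iff_eq_mul]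
  rw [wrBase_apply, wrBase_apply, wrTop_apply]
  simp only [wr_mul, Pi.one_apply, one_mul, mul_one]

theorem wr_conj_mulSingle (i : Fin p) (x : Equiv.Perm (Fin (p ^ k))) (δ : Equiv.Perm (Fin p)) :
    wrTop p k δ * wrBase p k (Pi.mulSingle i x) * (wrTop p k δ)⁻¹ =
      wrBase p k (Pi.mulSingle (δ i) x) := by
  rw [wr_conj]
  congr 1
  funext m
  by_cases h : m = δ i
  · subst h; simp
  · have h' : δ⁻¹ m ≠ i := by
      rintro rfl; simp at h
    rw [Pi.mulSingle_eq_of_ne h', Pi.mulSingle_eq_of_ne h]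

theorem rot_pow_apply (s : ℕ) (i : Fin p) : (rot p ^ s) i = i + Fin.ofNat p s := by
  induction s with
  | zero => simp
  | succ s ih =>
    rw [pow_succ', Equiv.Perm.mul_apply, ih]
    apply Fin.ext
    simp [rot, Fin.val_add, add_assoc]

theorem exists_rot_pow (m : Fin p) : ∃ s : ℕ, (rot p ^ s) 0 = m :=
  ⟨m.val, by rw [rot_pow_apply]; simp⟩

theorem wrTop_rot_mem : wrTop p k (rot p) ∈ Syl p (k + 1) :=
  Subgroup.subset_closure ⟨Fin.last k, by simp [gen, wrTop]⟩

theorem wrBase_zero_mem {x : Equiv.Perm (Fin (p ^ k))} (hx : x ∈ Syl p k) :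
    wrBase p k (Pi.mulSingle 0 x) ∈ Syl p (k + 1) := by
  have : Syl p k ≤ (Syl p (k + 1)).comap
      ((wrBase p k).comp (MonoidHom.mulSingle (fun _ : Fin p => Equiv.Perm (Fin (p ^ k))) 0)) := by
    refine (Subgroup.closure_le _).2 ?_
    rintro _ ⟨j, rfl⟩
    exact Subgroup.subset_closure ⟨j.castSucc, by simp [gen, wrBase]⟩
  exact this hx

theorem wrBase_single_mem (i : Fin p) {x : Equiv.Perm (Fin (p ^ k))} (hx : x ∈ Syl p k) :
    wrBase p k (Pi.mulSingle i x) ∈ Syl p (k + 1) := by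
  obtain ⟨s, rfl⟩ := exists_rot_pow i
  rw [← wr_conj_mulSingle, map_pow]
  have h := Subgroup.pow_mem _ (wrTop_rot_mem (p := p) (k := k)) s
  exact Subgroup.mul_mem _ (Subgroup.mul_mem _ h (wrBase_zero_mem hx)) (Subgroup.inv_mem _ h)

theorem wrBase_mem {f : Fin p → Equiv.Perm (Fin (p ^ k))} (hf : ∀ i, f i ∈ Syl p k) :
    wrBase p k f ∈ Syl p (k + 1) :=
  Subgroup.pi_mem_of_mulSingle_mem (H := (Syl p (k + 1)).comap (wrBase p k)) f
    fun i => wrBase_single_mem i (hf i)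

theorem wr_mem {f : Fin p → Equiv.Perm (Fin (p ^ k))} (hf : ∀ i, f i ∈ Syl p k) (s : ℕ) :
    wr f (rot p ^ s) ∈ Syl p (k + 1) := by
  rw [wr_eq, map_pow]
  exact Subgroup.mul_mem _ (wrBase_mem hf) (Subgroup.pow_mem _ wrTop_rot_mem s)

theorem residue_rot (i : Fin p) : residue p (rot p i) = residue p i + 1 := by
  simp [residue, rot]

theorem residue_rot_pow (s : ℕ) (i : Fin p) : residue p ((rot p ^ s) i) = residue p i + s := by
  induction s with
  | zero => simp
  | succ s ih => rw [pow_succ', Equiv.Perm.mul_apply, residue_rot, ih]; push_cast; ring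

theorem residue_sigmaOne (a : (ZMod p)ˣ) (i : Fin p) :
    residue p (sigmaOne a i) = a * residue p i := by
  simp [sigmaOne, Equiv.permCongr_apply]

theorem sigmaOne_conj (a : (ZMod p)ˣ) :
    sigmaOne a * rot p * (sigmaOne a)⁻¹ = rot p ^ (a : ZMod p).val := by
  rw [mul_inv_eq_iff_eq_mul]
  ext1 i
  apply (residue p).injective
  rw [Equiv.Perm.mul_apply, Equiv.Perm.mul_apply, residue_sigmaOne, residue_rot, residue_rot_pow,
    residue_sigmaOne, ZMod.natCast_zmod_val]
  ring

theorem mem_normalizer_of_gen {h : Equiv.Perm (Fin (p ^ k))}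
    (H : ∀ j, h * gen p k j * h⁻¹ ∈ Syl p k) : h ∈ Subgroup.normalizer (Syl p k : Set _) := by
  have hle : (Syl p k).map (MulAut.conj h).toMonoidHom ≤ Syl p k := by
    rw [Syl, MonoidHom.map_closure, Subgroup.closure_le]
    rintro _ ⟨_, ⟨j, rfl⟩, rfl⟩
    exact H j
  have heq := Subgroup.eq_of_le_of_card_ge hle (by
    rw [Subgroup.card_map_of_injective (MulAut.conj h).injective])
  rw [Subgroup.mem_normalizer_iff]
  intro g
  constructor
  · intro hg
    exact hle ⟨g, hg, rfl⟩
  · intro hg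
    rw [← SetLike.mem_coe, SetLike.mem_coe, ← heq] at hg
    obtain ⟨g', hg', e⟩ := hg
    have : g' = g := (MulAut.conj h).injective e
    exact this ▸ hg'

/-- `σ_j⁽ᵏ⁾` normalizes `P_{p ^ k}`. -/
theorem sigma_mem (a : (ZMod p)ˣ) :
    ∀ (k : ℕ) (j : Fin k), sigma a k j ∈ Subgroup.normalizer (Syl p k : Set _)
  | 0, j => j.elim0
  | k + 1, j => by
    apply mem_normalizer_of_gen
    have hlast : gen p (k + 1) (Fin.last k) = wrTop p k (rot p) := by simp [gen, wrTop]
    have hcast : ∀ i : Fin k, gen p (k + 1) i.castSucc =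
      wrBase p k (Pi.mulSingle 0 (gen p k i)) := fun i => by simp [gen, wrBase]
    have hgen : ∀ i : Fin k, gen p k i ∈ Syl p k := fun i => Subgroup.subset_closure ⟨i, rfl⟩
    induction j using Fin.lastCases with
    | last =>
      have hs : sigma a (k + 1) (Fin.last k) = wrTop p k (sigmaOne a) := by simp [sigma, wrTop]
      rw [hs]
      intro i
      induction i using Fin.lastCases with
      | last =>
        rw [hlast, ← map_inv, ← map_mul, ← map_mul, sigmaOne_conj, map_pow]
        exact Subgroup.pow_mem _ wrTop_rot_mem _
      | cast i =>
        rw [hcast, wr_conj_mulSingle]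
        exact wrBase_single_mem _ (hgen i)
    | cast j =>
      have hs : sigma a (k + 1) j.castSucc = wrBase p k (fun _ => sigma a k j) := by
        simp [sigma, wrBase]
      rw [hs]
      intro i
      induction i using Fin.lastCases with
      | last =>
        rw [hlast]
        have := wr_conj (p := p) (k := k) (fun _ => sigma a k j) (rot p)
        rw [mul_inv_eq_iff_eq_mul] at this
        rw [← this, mul_inv_cancel_right]
        exact wrTop_rot_mem
      | cast i =>
        rw [hcast, ← map_inv, ← map_mul, ← map_mul]
        apply wrBase_mem
        intro m
        have := (Subgroup.mem_normalizer_iff.1 (sigma_mem a k j) _).1 (hgen i)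
        by_cases hm : m = 0
        · subst hm; simpa using this
        · simp [Pi.mulSingle_eq_of_ne hm]

end facts

/-- The normalizer `N_{p ^ k}` of `P_{p ^ k}` in `S_{p ^ k}`. -/
abbrev Nor (p : ℕ) [NeZero p] (k : ℕ) : Subgroup (Equiv.Perm (Fin (p ^ k))) :=
  Subgroup.normalizer (Syl p k : Set (Equiv.Perm (Fin (p ^ k))))

/-- `σ_j⁽ᵏ⁾` as an element of `N_{p ^ k}`. -/
def sigmaN {p : ℕ} [NeZero p] (a : (ZMod p)ˣ) (k : ℕ) (j : Fin k) : Nor p k :=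
  ⟨sigma a k j, sigma_mem a k j⟩

/-- The element `(f₁, …, f_p; γ ^ s)` of `P_{p ^ (k + 1)} = P_{p ^ k} ≀ P_p`. -/
def wreath {p : ℕ} [NeZero p] {k : ℕ} (f : Fin p → Syl p k) (s : ℕ) : Syl p (k + 1) :=
  ⟨wr (fun i => (f i : Equiv.Perm (Fin (p ^ k)))) (rot p ^ s), wr_mem (fun i => (f i).2) s⟩

/-! ### Characters -/

/-- `χ` is the character of an irreducible complex representation of `G`. -/
def IsIrrChar {G : Type*} [Group G] (χ : G → ℂ) : Prop :=
  ∃ (n : ℕ) (ρ : Representation ℂ G (Fin n → ℂ)), ρ.IsIrreducible ∧ ρ.character = χ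

/-- The conjugate character `θ ^ h`, with `θ ^ h (g) = θ (g ^ (h⁻¹))`. -/
def conjChar {p : ℕ} [NeZero p] {k : ℕ} (h : Nor p k) (θ : Syl p k → ℂ) : Syl p k → ℂ := fun g =>
  θ ⟨(h : Equiv.Perm (Fin (p ^ k)))⁻¹ * g * h, (Subgroup.mem_normalizer_iff''.1 h.2 _).1 g.2⟩

open Classical in
/-- The character of a finite group `G` induced from the class function `ψ` of a group `H`, along an
injective homomorphism `ι`:
`g ↦ |H|⁻¹ ∑_{x ∈ G} ψ°(x⁻¹ g x)`, where `ψ°` is `ψ` on `ι(H) = H` and `0` elsewhere. -/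
noncomputable def indChar {G H : Type*} [Group G] [Group H] [Finite G] [Finite H]
    (ι : H → G) (ψ : H → ℂ) (g : G) : ℂ :=
  letI := Fintype.ofFinite G
  letI := Fintype.ofFinite H
  (Nat.card H : ℂ)⁻¹ * ∑ x : G, ∑ h : H, if ι h = x⁻¹ * g * x then ψ h else 0

/-- The character `(θ₁ × ⋯ × θ_p)↑` of `P_{p ^ (k + 1)}`, induced from the base group
`(P_{p ^ k}) ^ p`. -/
noncomputable def indProd {p : ℕ} [NeZero p] {k : ℕ} (θ : Fin p → Syl p k → ℂ) :
    Syl p (k + 1) → ℂ :=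
  indChar (fun f : Fin p → Syl p k => wreath f 0) fun f => ∏ i, θ i (f i)

/-- For a representation `V` of `G`, the action of `(f₁, …, f_p; δ)` on `V ⊗ ⋯ ⊗ V` (`p` factors),
`v₁ ⊗ ⋯ ⊗ v_p ↦ f₁ v_{δ⁻¹(1)} ⊗ ⋯ ⊗ f_p v_{δ⁻¹(p)}`. -/
noncomputable def tensorAct {p n : ℕ} {G : Type*} [Group G] (ρ : Representation ℂ G (Fin n → ℂ))
    (f : Fin p → G) (δ : Equiv.Perm (Fin p)) :
    (⨂[ℂ] _ : Fin p, (Fin n → ℂ)) →ₗ[ℂ] ⨂[ℂ] _ : Fin p, (Fin n → ℂ) :=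
  PiTensorProduct.map (fun i => ρ (f i)) ∘ₗ
    (PiTensorProduct.reindex ℂ (fun _ : Fin p => Fin n → ℂ) δ).toLinearMap

/-- `ω = exp (2 π i / p)`. -/
noncomputable def omega (p : ℕ) : ℂ := Complex.exp (2 * Real.pi * Complex.I / p)

/-- `θ` is the character `𝒳(φ; ε)` of `P_{p ^ (k + 1)} = P_{p ^ k} ≀ P_p`: the character of the
representation on `V ⊗ ⋯ ⊗ V`, where `V` affords `φ`, times the inflation of the linear character
`φ_ε` of `P_p`, which is given by `φ_ε (γ ^ s) = ω ^ (ε s)`. -/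
def IsX {p : ℕ} [NeZero p] {k : ℕ} (φ : Syl p k → ℂ) (ε : Fin p) (θ : Syl p (k + 1) → ℂ) : Prop :=
  ∃ (n : ℕ) (ρ : Representation ℂ (Syl p k) (Fin n → ℂ)), ρ.character = φ ∧
    ∀ (f : Fin p → Syl p k) (s : ℕ),
      θ (wreath f s) =
        LinearMap.trace ℂ _ (tensorAct ρ f (rot p ^ s)) * omega p ^ ((ε : ℕ) * s)

/-! ### Tree functions -/

/-- The `p ^ k`-skeleton: sequences of length less than `k` with symbols in `[1, p]`. -/
abbrev Skel (p k : ℕ) : Type := {s : List (Fin p) // s.length < k}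

/-- Labeling functions: the labels are in `[0, p]`. -/
abbrev LabelFn (p k : ℕ) : Type := Skel p k → Fin (p + 1)

/-- The sequence `(s₁)γ_{s⁰} (s₂)γ_{s¹} … (s_ℓ)γ_{s^{ℓ-1}}`, where `sⁱ = s₁ … s_i`. -/
def relabel {p : ℕ} : (List (Fin p) → Equiv.Perm (Fin p)) → List (Fin p) → List (Fin p)
  | _, [] => []
  | γ, i :: s => γ [] i :: relabel (fun q => γ (i :: q)) s

theorem relabel_length {p : ℕ} (γ : List (Fin p) → Equiv.Perm (Fin p)) (s : List (Fin p)) :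
    (relabel γ s).length = s.length := by
  induction s generalizing γ with
  | nil => rfl
  | cons i s ih => simp [relabel, ih]

theorem relabel_one {p : ℕ} (s : List (Fin p)) : relabel (fun _ => 1) s = s := by
  induction s with
  | nil => rfl
  | cons i s ih => simp [relabel, ih]

theorem relabel_relabel {p : ℕ} (γ γ' : List (Fin p) → Equiv.Perm (Fin p)) (s : List (Fin p)) :
    relabel γ' (relabel γ s) = relabel (fun q => γ' (relabel γ q) * γ q) s := by
  induction s generalizing γ γ' with
  | nil => rfl
  | cons i s ih => simp [relabel, ih]

theorem exists_relabel_inv {p : ℕ} (C : Subgroup (Equiv.Perm (Fin p)))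
    (γ : List (Fin p) → Equiv.Perm (Fin p)) (hγ : ∀ q, γ q ∈ C) :
    ∃ γ' : List (Fin p) → Equiv.Perm (Fin p), (∀ q, γ' q ∈ C) ∧
      ∀ s, relabel γ (relabel γ' s) = s := by
  have key : ∀ s : List (Fin p), ∃ g : (γ : List (Fin p) → Equiv.Perm (Fin p)) → List (Fin p),
      ∀ γ, relabel γ (g γ) = s := by
    intro s
    induction s with
    | nil => exact ⟨fun _ => [], fun _ => rfl⟩
    | cons i s ih =>
      obtain ⟨g, hg⟩ := ih
      exact ⟨fun γ => (γ [])⁻¹ i :: g (fun q => γ ((γ [])⁻¹ i :: q)), fun γ => by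
        simp [relabel, hg]⟩
  have inj : ∀ (s s' : List (Fin p)) (γ : List (Fin p) → Equiv.Perm (Fin p)),
      relabel γ s = relabel γ s' → s = s' := by
    intro s
    induction s with
    | nil =>
      intro s' γ h
      cases s' with
      | nil => rfl
      | cons i s' => simp [relabel] at h
    | cons i s ih =>
      intro s' γ h
      cases s' with
      | nil => simp [relabel] at h
      | cons i' s' =>
        simp only [relabel, List.cons.injEq, EmbeddingLike.apply_eq_iff_eq] at h
        obtain ⟨rfl, h⟩ := h
        rw [ih _ _ h]
  choose g hg using key
  refine ⟨fun q => (γ (g q γ))⁻¹, fun q => C.inv_mem (hγ _), fun s => ?_⟩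
  clear hγ
  induction s generalizing γ with
  | nil => rfl
  | cons i s ih =>
    have h0 : g [] γ = [] := inj _ _ γ (by rw [hg]; rfl)
    simp only [relabel, h0, List.cons.injEq]
    refine ⟨by simp, ?_⟩
    have h1 : ∀ q, g (i :: q) γ =
        (γ [])⁻¹ i :: g q (fun q => γ ((γ [])⁻¹ i :: q)) := fun q =>
      inj _ _ γ (by rw [hg]; simp [relabel, hg])
    simp only [h1]
    exact ih (fun q => γ ((γ [])⁻¹ i :: q))

/-- The equivalence relation on labeling functions: the subtrees below each vertex may be permuted
cyclically. (Only the values of `γ` at sequences of length less than `k - 1` matter.) -/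
def treeSetoid (p : ℕ) [NeZero p] (k : ℕ) : Setoid (LabelFn p k) where
  r t₁ t₂ := ∃ γ : List (Fin p) → Equiv.Perm (Fin p), (∀ q, γ q ∈ Subgroup.zpowers (rot p)) ∧
    ∀ s : Skel p k, t₁ s = t₂ ⟨relabel γ s, by rw [relabel_length]; exact s.2⟩
  iseqv :=
    { refl := fun t => ⟨fun _ => 1, fun _ => Subgroup.one_mem _, fun s => by simp [relabel_one]⟩
      symm := by
        rintro t₁ t₂ ⟨γ, hγ, h⟩
        obtain ⟨γ', hγ', h'⟩ := exists_relabel_inv _ γ hγ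
        exact ⟨γ', hγ', fun s => by rw [h]; simp [h']⟩
      trans := by
        rintro t₁ t₂ t₃ ⟨γ, hγ, h⟩ ⟨γ', hγ', h'⟩
        exact ⟨fun q => γ' (relabel γ q) * γ q, fun q => Subgroup.mul_mem _ (hγ' _) (hγ _),
          fun s => by rw [h, h']; simp [relabel_relabel]⟩ }

/-- `p ^ k`-tree functions: classes of labeling functions. -/
def TreeFn (p : ℕ) [NeZero p] (k : ℕ) : Type := Quotient (treeSetoid p k)

/-- The class of a labeling function. -/
def TreeFn.mk {p : ℕ} [NeZero p] {k : ℕ} (t : LabelFn p k) : TreeFn p k :=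
  Quotient.mk (treeSetoid p k) t

/-- The label of the root. -/
def LabelFn.root {p k : ℕ} (t : LabelFn p (k + 1)) : Fin (p + 1) := t ⟨[], Nat.succ_pos k⟩

/-- The labeling subfunction rooted at the `i`-th vertex below the root. -/
def LabelFn.sub {p k : ℕ} (t : LabelFn p (k + 1)) (i : Fin p) : LabelFn p k :=
  fun s => t ⟨i :: s, Nat.succ_lt_succ s.2⟩

/-- The labeling function `(f₁ | ⋯ | f_p; x)`. -/
def LabelFn.node {p k : ℕ} (f : Fin p → LabelFn p k) (x : Fin (p + 1)) : LabelFn p (k + 1)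
  | ⟨[], _⟩ => x
  | ⟨i :: s, h⟩ => f i ⟨s, Nat.lt_of_succ_lt_succ h⟩

/-- The tree function `(F₁ | ⋯ | F_p; x)`, the class of `(f₁ | ⋯ | f_p; x)` for any representatives
`f_i` of `F_i`. -/
noncomputable def TreeFn.node {p : ℕ} [NeZero p] {k : ℕ} (F : Fin p → TreeFn p k)
    (x : Fin (p + 1)) : TreeFn p (k + 1) :=
  TreeFn.mk (LabelFn.node (fun i => Quotient.out (F i)) x)

/-- Admissible labeling functions: leaves are not labelled by `p`, and at each other vertex the `p`
tree subfunctions below it are admissible, all equal if the label of the vertex is not `p`, and not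
all equal if it is `p`. -/
def LabelFn.Admissible {p : ℕ} [NeZero p] : {k : ℕ} → LabelFn p k → Prop
  | 0, _ => True
  | 1, t => LabelFn.root t ≠ Fin.last p
  | _ + 2, t => (∀ i, LabelFn.Admissible (LabelFn.sub t i)) ∧
      (LabelFn.root t ≠ Fin.last p →
        ∀ i j, TreeFn.mk (LabelFn.sub t i) = TreeFn.mk (LabelFn.sub t j)) ∧
      (LabelFn.root t = Fin.last p →
        ∃ i j, TreeFn.mk (LabelFn.sub t i) ≠ TreeFn.mk (LabelFn.sub t j))

/-- Admissible tree functions. -/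
def TreeFn.Admissible {p : ℕ} [NeZero p] {k : ℕ} (T : TreeFn p k) : Prop :=
  ∃ t : LabelFn p k, TreeFn.mk t = T ∧ LabelFn.Admissible t

open Classical in
/-- The map `Φ_{p ^ k}` from `Irr(P_{p ^ k})` to tree functions, `θ ↦ 𝒯(θ)`. It is built recursively
from `P_1 = 1`, whose tree function is the empty one; for `P_p` it sends `φ_ε = 𝒳(1; ε)` to the
one-vertex tree labelled by `ε`. The value in the last line is not attained at irreducible
characters. -/
noncomputable def treeOf {p : ℕ} [NeZero p] : {k : ℕ} → (Syl p k → ℂ) → TreeFn p k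
  | 0, _ => TreeFn.mk fun _ => 0
  | k + 1, θ =>
    if h : ∃ φε : (Syl p k → ℂ) × Fin p, IsIrrChar φε.1 ∧ IsX φε.1 φε.2 θ then
      TreeFn.node (fun _ => treeOf h.choose.1) h.choose.2.castSucc
    else if h : ∃ ϑ : Fin p → Syl p k → ℂ,
        (∀ i, IsIrrChar (ϑ i)) ∧ (∃ i j, ϑ i ≠ ϑ j) ∧ θ = indProd ϑ then
      TreeFn.node (fun i => treeOf (h.choose i)) (Fin.last p)
    else TreeFn.mk fun _ => 0

open Classical in
/-- The action of `N_{p ^ k}` on the tree functions of irreducible characters,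
`T ^ h = 𝒯(θ ^ h)` for the irreducible character `θ` with `𝒯(θ) = T`. -/
noncomputable def treeAct {p : ℕ} [NeZero p] {k : ℕ} (h : Nor p k) (T : TreeFn p k) : TreeFn p k :=
  if hT : ∃ θ : Syl p k → ℂ, IsIrrChar θ ∧ treeOf θ = T then treeOf (conjChar h hT.choose) else T

end SylowTree

open SylowTree

/-!
The restriction of an irreducible character `θ` of `P_{p ^ (k + 1)} = P_{p ^ k} ≀ P_p` to the base
group has an irreducible constituent `ϑ₁ × ⋯ × ϑ_p`. If the `ϑ_i` are not all equal then, `p` being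
prime, no nontrivial rotation fixes the family `ϑ`, so that `(ϑ₁ × ⋯ × ϑ_p)↑` is irreducible and
equal to `θ`. If they are all equal to `φ`, then `(φ × ⋯ × φ)↑` is the sum of the `p` different
irreducible characters `𝒳(φ; ε)`, and `θ` is one of them. In the first case `θ` determines `ϑ` up to
rotation, in the second it determines `φ` and `ε`; this makes `𝒯` injective and its values
admissible.

Conjugation by `σ_j⁽ᵏ⁺¹⁾` with `j ≤ k` conjugates each coordinate of the base group by `σ_j⁽ᵏ⁾` and
fixes the top group. Conjugation by `σ_{k+1}⁽ᵏ⁺¹⁾` permutes the coordinates according to `σ₁⁽¹⁾` and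
takes `γ` to `γ ^ b`, where `b = a⁻¹`, so that it permutes the `ϑ_i` and replaces `ε` by `b ε`.
-/

namespace SylowTree

section Characters

open Module RCLike
open scoped ComplexConjugate ComplexOrder

theorem wInner_cWeight_eq_sum {X : Type*} [Fintype X] (f g : X → ℂ) :
    ⟪f, g⟫ₙ_[ℂ] = (Fintype.card X : ℂ)⁻¹ * ∑ x, conj (f x) * g x := by
  simp [wInner, Finset.mul_sum, mul_comm]

theorem wInner_sum_right {X κ : Type*} [Fintype X] (s : Finset κ) (f : X → ℂ) (g : κ → X → ℂ) :
    ⟪f, ∑ i ∈ s, g i⟫ₙ_[ℂ] = ∑ i ∈ s, ⟪f, g i⟫ₙ_[ℂ] := by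
  simp only [wInner, Finset.sum_apply, inner_sum, Finset.smul_sum]
  exact Finset.sum_comm

theorem wInner_cWeight_self_re {X : Type*} [Fintype X] (f : X → ℂ) :
    (⟪f, f⟫ₙ_[ℂ]).re = (Fintype.card X : ℝ)⁻¹ * ∑ x, ‖f x‖ ^ 2 := by
  simp only [wInner, Complex.re_sum, Finset.mul_sum, inner_self_eq_norm_sq_to_K,
    Function.const_apply]
  refine Finset.sum_congr rfl fun x _ => ?_
  rw [Complex.smul_re]; norm_cast

theorem eq_zero_of_wInner_self_re_nonpos {X : Type*} [Fintype X] {f : X → ℂ}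
    (h : (⟪f, f⟫ₙ_[ℂ]).re ≤ 0) : f = 0 := by
  funext x
  have : Nonempty X := ⟨x⟩
  have hsum : ∑ x, ‖f x‖ ^ 2 = 0 := by
    refine le_antisymm (nonpos_of_mul_nonpos_right (a := (Fintype.card X : ℝ)⁻¹) ?_ ?_)
      (Finset.sum_nonneg fun _ _ => by positivity)
    · rwa [← wInner_cWeight_self_re]
    · positivity
  simpa using (Finset.sum_eq_zero_iff_of_nonneg fun _ _ => by positivity).1 hsum x
    (Finset.mem_univ x)

theorem eq_of_wInner_eq_natCast {X : Type*} [Fintype X] {α β : X → ℂ} (hα : ⟪α, α⟫ₙ_[ℂ] = 1)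
    (hβ : ⟪β, β⟫ₙ_[ℂ] = 1) {m : ℕ} (hm : m ≠ 0) (h : ⟪α, β⟫ₙ_[ℂ] = m) : α = β := by
  have h' : ⟪β, α⟫ₙ_[ℂ] = m := by rw [← conj_wInner_symm, h]; simp
  have hsub : (⟪α - β, α - β⟫ₙ_[ℂ]).re = 2 - 2 * m := by
    rw [wInner_sub_left, wInner_sub_right, wInner_sub_right, hα, hβ, h, h']
    simp; ring
  have hm' : (1 : ℝ) ≤ m := by exact_mod_cast Nat.one_le_iff_ne_zero.2 hm
  exact sub_eq_zero.1 (eq_zero_of_wInner_self_re_nonpos (by linarith))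

variable {G V W : Type*} [Group G] [AddCommGroup V] [Module ℂ V] [AddCommGroup W] [Module ℂ W]

theorem isIrreducible_of_equiv {ρ : Representation ℂ G V} {σ : Representation ℂ G W}
    (e : ρ.Equiv σ) (hρ : ρ.IsIrreducible) : σ.IsIrreducible := by
  have he (g : G) (v : V) : σ g (e v) = e (ρ g v) :=
    (Representation.IntertwiningMap.isIntertwining _ _ e.toIntertwiningMap g v).symm
  let o : Subrepresentation ρ ≃o Subrepresentation σ :=
    { toFun N := ⟨N.toSubmodule.map e.toLinearMap, by
        rintro g _ ⟨v, hv, rfl⟩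
        exact ⟨ρ g v, N.apply_mem_toSubmodule g hv, (he g v).symm⟩⟩
      invFun N := ⟨N.toSubmodule.comap e.toLinearMap, fun g v hv => by
        have := N.apply_mem_toSubmodule g hv
        rwa [Representation.Equiv.coe_toLinearMap, he] at this⟩
      left_inv N := Subrepresentation.ext
        (Submodule.comap_map_eq_of_injective (EquivLike.injective e) _)
      right_inv N := Subrepresentation.ext
        (Submodule.map_comap_eq_of_surjective (EquivLike.surjective e) _)
      map_rel_iff' := Submodule.map_le_map_iff_of_injective (EquivLike.injective e) _ _ }
  exact o.isSimpleOrder_iff.1 hρ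

theorem nontrivial_of_isIrreducible {ρ : Representation ℂ G V} (hρ : ρ.IsIrreducible) :
    Nontrivial V := by
  by_contra hV
  have := not_nontrivial_iff_subsingleton.1 hV
  obtain ⟨N, N', hne⟩ := hρ.toNontrivial.exists_pair_ne
  exact hne (Subrepresentation.ext (Subsingleton.elim _ _))

theorem isCompl_toSubmodule {ρ : Representation ℂ G V} {N N' : Subrepresentation ρ}
    (h : IsCompl N N') : IsCompl N.toSubmodule N'.toSubmodule :=
  ⟨disjoint_iff.2 (congrArg Subrepresentation.toSubmodule h.inf_eq_bot),
    codisjoint_iff.2 (congrArg Subrepresentation.toSubmodule h.sup_eq_top)⟩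

variable [FiniteDimensional ℂ V] [FiniteDimensional ℂ W]

theorem isIrrChar_character {ρ : Representation ℂ G V} (hρ : ρ.IsIrreducible) :
    IsIrrChar ρ.character := by
  let b : V ≃ₗ[ℂ] (Fin (finrank ℂ V) → ℂ) := (finBasis ℂ V).equivFun
  let σ : Representation ℂ G (Fin (finrank ℂ V) → ℂ) := (b.conjAlgEquiv ℂ : _ →* _).comp ρ
  let e : ρ.Equiv σ := Representation.Equiv.mk b fun g => by ext v; simp [σ]
  exact ⟨_, σ, isIrreducible_of_equiv e hρ, (Representation.char_iso e).symm⟩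

theorem IsIrrChar.apply_one_ne_zero {θ : G → ℂ} (hθ : IsIrrChar θ) :
    θ 1 ≠ 0 := by
  obtain ⟨n, ρ, hρ, rfl⟩ := hθ
  have := nontrivial_of_isIrreducible hρ
  rw [Representation.char_one]
  exact_mod_cast Module.finrank_pos.ne'

theorem character_eq_add_of_isCompl {ρ : Representation ℂ G V} {N N' : Subrepresentation ρ}
    (h : IsCompl N.toSubmodule N'.toSubmodule) :
    ρ.character = N.toRepresentation.character + N'.toRepresentation.character := by
  funext g
  have hi : DirectSum.IsInternal fun b : Bool => cond b N.toSubmodule N'.toSubmodule := by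
    rw [DirectSum.isInternal_submodule_iff_isCompl _ (i := true) (j := false) (by simp)]
    · exact h
    · ext b; cases b <;> simp
  refine (LinearMap.trace_eq_sum_trace_restrict hi (f := ρ g) ?_).trans (Fintype.sum_bool _)
  rintro (_ | _)
  · exact N'.apply_mem_toSubmodule g
  · exact N.apply_mem_toSubmodule g

theorem exists_posDef_conjTranspose_mul_mul_eq [Finite G] {n : Type*} [Fintype n]
    [DecidableEq n] (A : G →* Matrix n n ℂ) :
    ∃ M : Matrix n n ℂ, M.PosDef ∧ ∀ g, (A g).conjTranspose * M * A g = M := by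
  have := Fintype.ofFinite G
  refine ⟨∑ h, (A h).conjTranspose * A h, ?_, fun g => ?_⟩
  · classical
    rw [← Finset.add_sum_erase _ _ (Finset.mem_univ 1), map_one, mul_one,
      Matrix.conjTranspose_one]
    exact Matrix.PosDef.one.add_posSemidef
      (Matrix.posSemidef_sum _ fun h _ => Matrix.posSemidef_conjTranspose_mul_self _)
  · simp only [Finset.mul_sum, Finset.sum_mul]
    refine Fintype.sum_bijective (· * g) (Group.mulRight_bijective g) _ _ fun h => ?_
    simp only [map_mul, Matrix.conjTranspose_mul, mul_assoc]

theorem character_inv [Finite G] (ρ : Representation ℂ G V) (g : G) :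
    ρ.character g⁻¹ = conj (ρ.character g) := by
  let b := finBasis ℂ V
  let A : G →* Matrix _ _ ℂ := (LinearMap.toMatrixAlgEquiv b).toAlgHom.toMonoidHom.comp ρ
  have htr (g : G) : ρ.character g = (A g).trace := LinearMap.trace_eq_matrix_trace ℂ b _
  obtain ⟨M, hM, hinv⟩ := exists_posDef_conjTranspose_mul_mul_eq A
  have hu : IsUnit M.det := (Matrix.isUnit_iff_isUnit_det _).1 hM.isUnit
  have hsim : M * A g⁻¹ = (A g).conjTranspose * M := by
    conv_lhs => rw [← hinv g]
    rw [mul_assoc, ← map_mul, mul_inv_cancel, map_one, mul_one]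
  calc ρ.character g⁻¹ = (M⁻¹ * (M * A g⁻¹)).trace := by
        rw [htr, Matrix.nonsing_inv_mul_cancel_left _ _ hu]
    _ = (A g).conjTranspose.trace := by
        rw [hsim, Matrix.trace_mul_comm, Matrix.mul_nonsing_inv_cancel_right _ _ hu]
    _ = conj (ρ.character g) := by rw [Matrix.trace_conjTranspose, htr]; rfl

theorem wInner_character [Fintype G] (ρ : Representation ℂ G V) (σ : Representation ℂ G W) :
    ⟪ρ.character, σ.character⟫ₙ_[ℂ] = finrank ℂ (ρ.IntertwiningMap σ) := by
  have : Invertible (Nat.card G : ℂ) := invertibleOfNonzero (by simp)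
  rw [← Representation.card_inv_mul_sum_char_mul_char_eq_finrank]
  simp [wInner, character_inv, Finset.mul_sum]

theorem IsIrrChar.wInner_self [Fintype G] {α : G → ℂ} (hα : IsIrrChar α) : ⟪α, α⟫ₙ_[ℂ] = 1 := by
  obtain ⟨n, ρ, hρ, rfl⟩ := hα
  rw [wInner_character, Representation.IsIrreducible.finrank_intertwiningMap_self, Nat.cast_one]

open Classical in
theorem IsIrrChar.wInner_eq [Fintype G] {α β : G → ℂ} (hα : IsIrrChar α) (hβ : IsIrrChar β) :
    ⟪α, β⟫ₙ_[ℂ] = if α = β then 1 else 0 := by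
  split_ifs with h
  · rw [← h, hα.wInner_self]
  · obtain ⟨n, ρ, hρ, rfl⟩ := hα
    obtain ⟨m, σ, hσ, rfl⟩ := hβ
    have : IsEmpty (ρ.Equiv σ) := ⟨fun e => h (Representation.char_iso e)⟩
    rw [wInner_character, finrank_zero_of_subsingleton, Nat.cast_zero]

theorem IsIrrChar.eq_of_subsingleton [Subsingleton G] {α β : G → ℂ} (hα : IsIrrChar α)
    (hβ : IsIrrChar β) : α = β := by
  classical
  by_contra h
  have : Unique G := uniqueOfSubsingleton 1
  have h0 := hα.wInner_eq hβ
  rw [if_neg h, wInner_cWeight_eq_sum] at h0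
  simp [Subsingleton.elim default (1 : G), hα.apply_one_ne_zero, hβ.apply_one_ne_zero] at h0

theorem nonempty_equiv_of_character_eq [Finite G] {ρ : Representation ℂ G V}
    {σ : Representation ℂ G W} (hρ : ρ.IsIrreducible) (h : ρ.character = σ.character) :
    Nonempty (ρ.Equiv σ) := by
  have := Fintype.ofFinite G
  have hdim : finrank ℂ V = finrank ℂ W := by
    have := congrFun h 1
    rw [Representation.char_one, Representation.char_one] at this
    exact_mod_cast this
  have hone : finrank ℂ (ρ.IntertwiningMap σ) = 1 := by
    rw [← Nat.cast_inj (R := ℂ), ← wInner_character, ← h, (isIrrChar_character hρ).wInner_self,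
      Nat.cast_one]
  have : Nontrivial (ρ.IntertwiningMap σ) := nontrivial_of_finrank_pos (R := ℂ) (by omega)
  obtain ⟨f, hf⟩ := exists_ne (0 : ρ.IntertwiningMap σ)
  have hinj := (Representation.IsIrreducible.injective_or_eq_zero f).resolve_right hf
  exact ⟨f.ofBijective
    ⟨hinj, (LinearMap.injective_iff_surjective_of_finrank_eq_finrank (f := f.toLinearMap) hdim).1
      hinj⟩⟩

theorem exists_isCompl_finrank_lt [Finite G] [Nontrivial V] {ρ : Representation ℂ G V}
    (hρ : ¬ ρ.IsIrreducible) :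
    ∃ N N' : Subrepresentation ρ, IsCompl N N' ∧ finrank ℂ N.toSubmodule < finrank ℂ V ∧
      finrank ℂ N'.toSubmodule < finrank ℂ V := by
  have : Nontrivial (Subrepresentation ρ) :=
    ⟨⊥, ⊤, fun h => bot_ne_top (congrArg Subrepresentation.toSubmodule h)⟩
  obtain ⟨N, hbot, htop⟩ : ∃ N : Subrepresentation ρ, N ≠ ⊥ ∧ N ≠ ⊤ := by
    by_contra! h
    exact hρ ⟨fun N => or_iff_not_imp_left.2 (h N)⟩
  obtain ⟨N', hN⟩ := exists_isCompl N
  refine ⟨N, N', hN, Submodule.finrank_lt fun h => htop (Subrepresentation.ext h),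
    Submodule.finrank_lt fun h => hbot ?_⟩
  rw [← inf_top_eq N, ← show N' = ⊤ from Subrepresentation.ext h, hN.inf_eq_bot]

theorem character_mem_span_isIrrChar [Finite G] (ρ : Representation ℂ G V) :
    ρ.character ∈ Submodule.span ℂ {χ : G → ℂ | IsIrrChar χ} := by
  induction hn : finrank ℂ V using Nat.strong_induction_on generalizing V with
  | _ n ih =>
    subst hn
    cases subsingleton_or_nontrivial V with
    | inl hV =>
      have : ρ.character = 0 := by
        funext g
        rw [Representation.character, Subsingleton.elim (ρ g) 0, map_zero, Pi.zero_apply]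
      exact this ▸ Submodule.zero_mem _
    | inr hV =>
      by_cases hρ : ρ.IsIrreducible
      · exact Submodule.subset_span (isIrrChar_character hρ)
      obtain ⟨N, N', hN, hlt, hlt'⟩ := exists_isCompl_finrank_lt hρ
      rw [character_eq_add_of_isCompl (isCompl_toSubmodule hN)]
      exact Submodule.add_mem _ (ih _ hlt _ rfl) (ih _ hlt' _ rfl)

open Classical in
theorem character_leftRegular [Finite G] :
    (Representation.leftRegular ℂ G).character = (Nat.card G : ℂ) • Pi.single 1 1 := by
  have := Fintype.ofFinite G
  funext g
  let b : Basis G ℂ (MonoidAlgebra ℂ G) := .ofRepr (MonoidAlgebra.coeffLinearEquiv ℂ)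
  rw [Representation.character, LinearMap.trace_eq_matrix_trace ℂ b, Matrix.trace]
  simp [LinearMap.toMatrix_apply, b, Finsupp.single_apply, Pi.single_apply]

open Classical in
theorem pi_single_one_mem_span_isIrrChar [Finite G] :
    Pi.single 1 1 ∈ Submodule.span ℂ {χ : G → ℂ | IsIrrChar χ} := by
  have h := character_mem_span_isIrrChar (Representation.leftRegular ℂ G)
  rw [character_leftRegular] at h
  exact (Submodule.smul_mem_iff _ (Nat.cast_ne_zero.2 Nat.card_pos.ne')).1 h

end Characters

section ExternalProducts

open Module RCLike

theorem trace_piTensorProduct_map {ι R : Type*} [Fintype ι] [CommRing R] {M : ι → Type*}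
    [∀ i, AddCommGroup (M i)] [∀ i, Module R (M i)] [∀ i, Module.Free R (M i)]
    [∀ i, Module.Finite R (M i)] (A : ∀ i, M i →ₗ[R] M i) :
    LinearMap.trace R _ (PiTensorProduct.map A) = ∏ i, LinearMap.trace R _ (A i) := by
  classical
  let b := fun i => Module.Free.chooseBasis R (M i)
  rw [LinearMap.trace_eq_matrix_trace R (Basis.piTensorProduct b)]
  simp only [fun i => LinearMap.trace_eq_matrix_trace R (b i) (A i), Matrix.trace,
    Matrix.diag_apply]
  rw [Finset.prod_univ_sum, Fintype.piFinset_univ]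
  refine Finset.sum_congr rfl fun v _ => ?_
  simp [LinearMap.toMatrix_apply]

variable {ι H : Type*} [Fintype ι]

/-- The external product `ψ₁ × ⋯ × ψ_n` of functions on `H`, a function on `H ^ n`. -/
def extProd (ψ : ι → H → ℂ) (f : ι → H) : ℂ := ∏ i, ψ i (f i)

/-- The external tensor product of representations of `H`, a representation of `H ^ n`. -/
noncomputable def extTensor [Group H] {n : ι → ℕ}
    (ρ : ∀ i, Representation ℂ H (Fin (n i) → ℂ)) :
    Representation ℂ (ι → H) (⨂[ℂ] i, (Fin (n i) → ℂ)) :=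
  PiTensorProduct.mapMonoidHom.comp
    (MonoidHom.pi fun i => (ρ i : H →* _).comp (Pi.evalMonoidHom (fun _ : ι => H) i))

theorem character_extTensor [Group H] {n : ι → ℕ}
    (ρ : ∀ i, Representation ℂ H (Fin (n i) → ℂ)) :
    (extTensor ρ).character = extProd fun i => (ρ i).character :=
  funext fun f => trace_piTensorProduct_map fun i => ρ i (f i)

theorem extProd_pi_single_one [One H] [DecidableEq H] [DecidableEq (ι → H)] :
    extProd (fun _ : ι => Pi.single (1 : H) (1 : ℂ)) = Pi.single 1 1 := by
  funext f
  simp [extProd, Pi.single_apply, Finset.prod_ite_zero, funext_iff]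

theorem extProd_mem_span {S : Set (H → ℂ)} {ψ : ι → H → ℂ}
    (hψ : ∀ i, ψ i ∈ Submodule.span ℂ S) :
    extProd ψ ∈ Submodule.span ℂ {α | ∃ χ : ι → H → ℂ, (∀ i, χ i ∈ S) ∧ extProd χ = α} := by
  classical
  choose c s hs _ hc using fun i => Submodule.mem_span_iff_exists_finset_subset.1 (hψ i)
  have hexpand : extProd ψ = ∑ χ ∈ Fintype.piFinset s, (∏ i, c i (χ i)) • extProd χ := by
    funext f
    simp only [extProd, ← hc, Finset.sum_apply, Pi.smul_apply, smul_eq_mul, Finset.prod_univ_sum,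
      Finset.prod_mul_distrib]
  rw [hexpand]
  refine Submodule.sum_mem _ fun χ hχ => Submodule.smul_mem _ _ (Submodule.subset_span ⟨χ, ?_, rfl⟩)
  exact fun i => hs i (Fintype.mem_piFinset.1 hχ i)

variable [DecidableEq ι] [Fintype H]

theorem wInner_extProd (ψ ψ' : ι → H → ℂ) :
    ⟪extProd ψ, extProd ψ'⟫ₙ_[ℂ] = ∏ i, ⟪ψ i, ψ' i⟫ₙ_[ℂ] := by
  simp only [wInner, extProd, Finset.prod_univ_sum, Fintype.piFinset_univ]
  refine Finset.sum_congr rfl fun f _ => ?_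
  simp [Finset.prod_mul_distrib]

variable [Group H]

open Classical in
theorem wInner_extProd_of_isIrrChar {ψ ψ' : ι → H → ℂ} (hψ : ∀ i, IsIrrChar (ψ i))
    (hψ' : ∀ i, IsIrrChar (ψ' i)) :
    ⟪extProd ψ, extProd ψ'⟫ₙ_[ℂ] = if ψ = ψ' then 1 else 0 := by
  simp only [wInner_extProd, fun i => (hψ i).wInner_eq (hψ' i), Finset.prod_ite_zero,
    Finset.prod_const_one, Finset.mem_univ, true_imp_iff, funext_iff (f := ψ)]

theorem eq_of_extProd_eq {ι H : Type*} [Fintype ι] [Group H] [Finite H] {ψ ψ' : ι → H → ℂ}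
    (hψ : ∀ i, IsIrrChar (ψ i)) (hψ' : ∀ i, IsIrrChar (ψ' i)) (h : extProd ψ = extProd ψ') :
    ψ = ψ' := by
  classical
  have := Fintype.ofFinite H
  by_contra hne
  have h0 := wInner_extProd_of_isIrrChar hψ hψ'
  rw [← h, wInner_extProd_of_isIrrChar hψ hψ, if_pos rfl, if_neg hne] at h0
  exact one_ne_zero h0

theorem exists_nat_wInner_extProd {V : Type*} [AddCommGroup V] [Module ℂ V]
    [FiniteDimensional ℂ V] (ρ : Representation ℂ (ι → H) V) {ψ : ι → H → ℂ}
    (hψ : ∀ i, IsIrrChar (ψ i)) : ∃ m : ℕ, ⟪extProd ψ, ρ.character⟫ₙ_[ℂ] = m := by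
  choose n σ _ hσ using hψ
  obtain rfl : (fun i => (σ i).character) = ψ := funext hσ
  exact ⟨_, by rw [← character_extTensor, wInner_character]⟩

theorem exists_wInner_extProd_ne_zero {α : (ι → H) → ℂ} (hα : α 1 ≠ 0) :
    ∃ ψ : ι → H → ℂ, (∀ i, IsIrrChar (ψ i)) ∧ ⟪extProd ψ, α⟫ₙ_[ℂ] ≠ 0 := by
  classical
  by_contra! h
  have hspan : ∀ β ∈ Submodule.span ℂ {β : (ι → H) → ℂ | ∃ χ : ι → H → ℂ,
      (∀ i, χ i ∈ {χ : H → ℂ | IsIrrChar χ}) ∧ extProd χ = β}, ⟪β, α⟫ₙ_[ℂ] = 0 := by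
    intro β hβ
    induction hβ using Submodule.span_induction with
    | mem β hβ => obtain ⟨χ, hχ, rfl⟩ := hβ; exact h χ hχ
    | zero => exact wInner_zero_left _ _
    | add β β' _ _ e e' => rw [wInner_add_left, e, e', add_zero]
    | smul c β _ e => rw [wInner_smul_left, e, smul_zero]
  have := hspan _ (extProd_mem_span fun _ => pi_single_one_mem_span_isIrrChar)
  rw [extProd_pi_single_one] at this
  simp [wInner, Pi.single_apply, hα] at this

end ExternalProducts

section WreathProduct

variable {p : ℕ} [NeZero p] {k : ℕ}

/-- The power `γ ^ r` of the `p`-cycle `γ`, with the exponent a residue modulo `p`. -/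
def rotBy (r : ZMod p) : Equiv.Perm (Fin p) := (residue p).symm.permCongr (Equiv.addRight r)

theorem residue_rotBy (r : ZMod p) (i : Fin p) : residue p (rotBy r i) = residue p i + r := by
  simp [rotBy, Equiv.permCongr_apply]

theorem rotBy_zero : rotBy (0 : ZMod p) = 1 :=
  Equiv.ext fun i => (residue p).injective (by simp [residue_rotBy])

theorem rotBy_mul (r r' : ZMod p) : rotBy r * rotBy r' = rotBy (r + r') :=
  Equiv.ext fun i => (residue p).injective (by simp [residue_rotBy, add_right_comm, add_assoc])

theorem rotBy_inv (r : ZMod p) : (rotBy r)⁻¹ = rotBy (-r) :=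
  inv_eq_of_mul_eq_one_left (by rw [rotBy_mul, neg_add_cancel, rotBy_zero])

theorem rotBy_injective : Function.Injective (rotBy (p := p)) := fun r r' h => by
  simpa [residue_rotBy] using congrArg (fun δ => residue p (δ 0)) h

theorem rot_pow_eq_rotBy (s : ℕ) : rot p ^ s = rotBy (s : ZMod p) :=
  Equiv.ext fun i => (residue p).injective (by rw [residue_rot_pow, residue_rotBy])

theorem mem_zpowers_rot_iff {δ : Equiv.Perm (Fin p)} :
    δ ∈ Subgroup.zpowers (rot p) ↔ ∃ r, rotBy r = δ := by
  rw [← mem_powers_iff_mem_zpowers]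
  constructor
  · rintro ⟨s, rfl⟩
    exact ⟨s, (rot_pow_eq_rotBy s).symm⟩
  · rintro ⟨r, rfl⟩
    exact ⟨r.val, by simp [rot_pow_eq_rotBy]⟩

theorem sigmaOne_mul_rotBy (a : (ZMod p)ˣ) (r : ZMod p) :
    sigmaOne a * rotBy r = rotBy ((a : ZMod p) * r) * sigmaOne a :=
  Equiv.ext fun i => (residue p).injective (by
    simp [residue_sigmaOne, residue_rotBy, mul_add])

theorem wr_inj {f f' : Fin p → Equiv.Perm (Fin (p ^ k))} {δ δ' : Equiv.Perm (Fin p)} :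
    wr f δ = wr f' δ' ↔ f = f' ∧ δ = δ' := by
  refine ⟨fun h => ?_, fun h => by rw [h.1, h.2]⟩
  have hpair (m : Fin p) (r : Fin (p ^ k)) : (δ m, f (δ m) r) = (δ' m, f' (δ' m) r) :=
    Equiv.congr_fun ((blockEquiv p k).permCongr.injective h) (m, r)
  obtain rfl : δ = δ' := Equiv.ext fun m => congrArg Prod.fst (hpair m 0)
  refine ⟨funext fun m => Equiv.ext fun r => ?_, rfl⟩
  simpa using congrArg Prod.snd (hpair (δ⁻¹ m) r)

/-- The element `(f₁, …, f_p; γ ^ r)` of `P_{p ^ (k + 1)} = P_{p ^ k} ≀ P_p`. Unlike in `wreath`,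
the exponent is a residue modulo `p`, which makes the pair `(f, r)` unique. -/
def wreathBy (f : Fin p → Syl p k) (r : ZMod p) : Syl p (k + 1) := wreath f r.val

theorem coe_wreathBy (f : Fin p → Syl p k) (r : ZMod p) :
    (wreathBy f r : Equiv.Perm (Fin (p ^ (k + 1)))) =
      wr (fun i => (f i : Equiv.Perm (Fin (p ^ k)))) (rotBy r) := by
  simp [wreathBy, wreath, rot_pow_eq_rotBy]

theorem wreath_eq_wreathBy (f : Fin p → Syl p k) (s : ℕ) : wreath f s = wreathBy f s :=
  Subtype.ext (by rw [coe_wreathBy, ← rot_pow_eq_rotBy, wreath])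

theorem wreathBy_inj {f f' : Fin p → Syl p k} {r r' : ZMod p} :
    wreathBy f r = wreathBy f' r' ↔ f = f' ∧ r = r' := by
  rw [← Subtype.coe_inj, coe_wreathBy, coe_wreathBy, wr_inj, rotBy_injective.eq_iff]
  simp only [funext_iff, SetLike.coe_eq_coe]

theorem wreathBy_mul (f f' : Fin p → Syl p k) (r r' : ZMod p) :
    wreathBy f r * wreathBy f' r' = wreathBy (fun m => f m * f' (rotBy (-r) m)) (r + r') :=
  Subtype.ext (by
    simp only [Subgroup.coe_mul, coe_wreathBy, wr_mul, rotBy_inv, rotBy_mul])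

theorem wreathBy_one : wreathBy (1 : Fin p → Syl p k) 0 = 1 :=
  Subtype.ext (by rw [coe_wreathBy, rotBy_zero]; exact wr_one)

theorem wreathBy_inv (f : Fin p → Syl p k) (r : ZMod p) :
    (wreathBy f r)⁻¹ = wreathBy (fun m => (f (rotBy r m))⁻¹) (-r) :=
  inv_eq_of_mul_eq_one_left (by simpa [wreathBy_mul, Pi.one_def] using wreathBy_one (p := p))

theorem gen_mem_range_wreathBy (j : Fin (k + 1)) :
    ∃ (f : Fin p → Syl p k) (r : ZMod p),
      (wreathBy f r : Equiv.Perm (Fin (p ^ (k + 1)))) = gen p (k + 1) j := by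
  induction j using Fin.lastCases with
  | last =>
    refine ⟨1, 1, ?_⟩
    have h1 : rotBy (1 : ZMod p) = rot p := by simpa using (rot_pow_eq_rotBy (p := p) 1).symm
    simp [coe_wreathBy, h1, gen, Pi.one_def]
  | cast j =>
    refine ⟨Pi.mulSingle 0 ⟨gen p k j, Subgroup.subset_closure ⟨j, rfl⟩⟩, 0, ?_⟩
    rw [coe_wreathBy, rotBy_zero]
    simp only [gen, Fin.lastCases_castSucc]
    congr 1
    exact funext fun i => Pi.apply_mulSingle (fun _ => (Syl p k).subtype) (fun _ => map_one _) 0 _ i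

theorem exists_wreathBy (g : Syl p (k + 1)) : ∃ f r, wreathBy f r = g := by
  obtain ⟨g, hg⟩ := g
  simp only [← Subtype.coe_inj]
  induction hg using Subgroup.closure_induction with
  | mem g hg =>
    obtain ⟨j, rfl⟩ := hg
    exact gen_mem_range_wreathBy j
  | one => exact ⟨1, 0, congrArg Subtype.val wreathBy_one⟩
  | mul g g' _ _ h h' =>
    obtain ⟨f, r, rfl⟩ := h
    obtain ⟨f', r', rfl⟩ := h'
    exact ⟨_, _, congrArg Subtype.val (wreathBy_mul f f' r r').symm⟩
  | inv g _ h =>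
    obtain ⟨f, r, rfl⟩ := h
    exact ⟨_, _, congrArg Subtype.val (wreathBy_inv f r).symm⟩

/-- The decomposition of `P_{p ^ (k + 1)}` as a wreath product. -/
noncomputable def wreathEquiv (p : ℕ) [NeZero p] (k : ℕ) :
    (Fin p → Syl p k) × ZMod p ≃ Syl p (k + 1) :=
  Equiv.ofBijective (fun x => wreathBy x.1 x.2)
    ⟨fun _ _ h => Prod.ext (wreathBy_inj.1 h).1 (wreathBy_inj.1 h).2, fun g =>
      let ⟨f, r, h⟩ := exists_wreathBy g
      ⟨(f, r), h⟩⟩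

theorem wreathEquiv_apply (f : Fin p → Syl p k) (r : ZMod p) :
    wreathEquiv p k (f, r) = wreathBy f r := rfl

/-- The embedding of the base group `(P_{p ^ k}) ^ p` into `P_{p ^ (k + 1)}`. -/
def wreathBase (p : ℕ) [NeZero p] (k : ℕ) : (Fin p → Syl p k) →* Syl p (k + 1) where
  toFun f := wreathBy f 0
  map_one' := wreathBy_one
  map_mul' f f' := by
    rw [wreathBy_mul, neg_zero, rotBy_zero, add_zero]
    rfl

theorem wreathBase_apply (f : Fin p → Syl p k) : wreathBase p k f = wreathBy f 0 := rfl

theorem wreathBase_injective (p : ℕ) [NeZero p] (k : ℕ) : Function.Injective (wreathBase p k) :=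
  fun _ _ h => (wreathBy_inj.1 h).1

noncomputable instance : Fintype (Syl p k) := Fintype.ofFinite _

theorem sum_syl_succ {M : Type*} [AddCommMonoid M] (F : Syl p (k + 1) → M) :
    ∑ g, F g = ∑ r : ZMod p, ∑ f : Fin p → Syl p k, F (wreathBy f r) := by
  rw [← (wreathEquiv p k).sum_comp, Fintype.sum_prod_type_right]
  rfl

end WreathProduct

section InducedCharacters

open RCLike
open scoped ComplexConjugate

variable {G H : Type*} [Group G] [Group H]

/-- Class functions on `G`, the functions to which Frobenius reciprocity for `indChar` applies. -/
def IsClassFun (θ : G → ℂ) : Prop := ∀ x g, θ (x⁻¹ * g * x) = θ g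

theorem isClassFun_character {V : Type*} [AddCommGroup V] [Module ℂ V]
    (ρ : Representation ℂ G V) : IsClassFun ρ.character := fun x g => by
  simpa using ρ.char_conj g x⁻¹

theorem IsIrrChar.isClassFun {θ : G → ℂ} (hθ : IsIrrChar θ) : IsClassFun θ := by
  obtain ⟨n, ρ, -, rfl⟩ := hθ
  exact isClassFun_character ρ

theorem indChar_apply [Fintype G] [Fintype H] [DecidableEq G] (ι : H → G) (ψ : H → ℂ) (g : G) :
    indChar ι ψ g =
      (Fintype.card H : ℂ)⁻¹ * ∑ x : G, ∑ h : H, if ι h = x⁻¹ * g * x then ψ h else 0 := by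
  rw [indChar, Nat.card_eq_fintype_card]
  congr! 3 <;> congr! 2

theorem indChar_equiv {G' H' : Type*} [Group G'] [Group H'] [Finite G] [Finite H] [Finite G']
    [Finite H'] (φ : G ≃* G') (e : H ≃ H') {ι : H → G} {ι' : H' → G'}
    (hι : ∀ h, ι' (e h) = φ (ι h)) (ψ : H' → ℂ) (g : G) :
    indChar ι' ψ (φ g) = indChar ι (ψ ∘ e) g := by
  classical
  cases nonempty_fintype G; cases nonempty_fintype H
  cases nonempty_fintype G'; cases nonempty_fintype H'
  simp only [indChar_apply, ← φ.toEquiv.sum_comp, ← e.sum_comp, MulEquiv.toEquiv_eq_coe,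
    MulEquiv.coe_toEquiv, Fintype.card_congr e, hι, ← map_inv, ← map_mul, φ.injective.eq_iff,
    Function.comp_apply]

theorem isClassFun_indChar [Finite G] [Finite H] (ι : H → G) (ψ : H → ℂ) :
    IsClassFun (indChar ι ψ) := fun x g => by
  classical
  cases nonempty_fintype G; cases nonempty_fintype H
  rw [indChar_apply, indChar_apply, ← Equiv.sum_comp (Equiv.mulLeft x) fun y =>
    ∑ h : H, if ι h = y⁻¹ * g * y then ψ h else 0]
  simp only [Equiv.coe_mulLeft, mul_inv_rev, mul_assoc]

theorem wInner_indChar [Fintype G] [Fintype H] (ι : H → G) (ψ : H → ℂ) {θ : G → ℂ}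
    (hθ : IsClassFun θ) : ⟪indChar ι ψ, θ⟫ₙ_[ℂ] = ⟪ψ, θ ∘ ι⟫ₙ_[ℂ] := by
  classical
  have hG : (Fintype.card G : ℂ) ≠ 0 := by exact_mod_cast Fintype.card_ne_zero
  have hconj (h : H) (x g : G) : ι h = x⁻¹ * g * x ↔ g = x * ι h * x⁻¹ := by
    rw [eq_mul_inv_iff_mul_eq, eq_comm, mul_assoc, inv_mul_eq_iff_eq_mul]
  have hsum (x : G) (h : H) :
      ∑ g, (if ι h = x⁻¹ * g * x then conj (ψ h) else 0) * θ g = conj (ψ h) * θ (ι h) := by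
    simp only [hconj, ite_mul, zero_mul, Finset.sum_ite_eq', Finset.mem_univ, if_true]
    rw [← hθ x⁻¹ (ι h), inv_inv]
  have hswap : ∑ g, (∑ x : G, ∑ h, if ι h = x⁻¹ * g * x then conj (ψ h) else 0) * θ g =
      Fintype.card G * ∑ h, conj (ψ h) * θ (ι h) := by
    simp only [Finset.sum_mul]
    rw [Finset.sum_comm, Finset.sum_congr rfl fun x _ => Finset.sum_comm]
    simp only [hsum, Finset.sum_const, Finset.card_univ, nsmul_eq_mul]
  simp only [wInner_cWeight_eq_sum, indChar_apply, map_mul, map_sum, map_inv₀, map_natCast,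
    apply_ite conj, map_zero, Function.comp_apply, mul_assoc (_⁻¹ : ℂ), ← Finset.mul_sum, hswap]
  field_simp

end InducedCharacters

section InducedProducts

open RCLike

variable {p : ℕ} [NeZero p] {k : ℕ}

theorem indProd_eq (ϑ : Fin p → Syl p k → ℂ) :
    indProd ϑ = indChar (wreathBase p k) (extProd ϑ) := by
  unfold indProd
  simp only [wreath_eq_wreathBy, Nat.cast_zero]
  rfl

theorem isClassFun_indProd (ϑ : Fin p → Syl p k → ℂ) : IsClassFun (indProd ϑ) := by
  rw [indProd_eq]
  exact isClassFun_indChar _ _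

theorem wInner_indProd_left (ϑ : Fin p → Syl p k → ℂ) {θ : Syl p (k + 1) → ℂ}
    (hθ : IsClassFun θ) : ⟪indProd ϑ, θ⟫ₙ_[ℂ] = ⟪extProd ϑ, θ ∘ wreathBase p k⟫ₙ_[ℂ] := by
  rw [indProd_eq, wInner_indChar _ _ hθ]

theorem conj_wreathBase (u f : Fin p → Syl p k) (r : ZMod p) :
    (wreathBy u r)⁻¹ * wreathBase p k f * wreathBy u r = wreathBase p k fun i =>
      (u (rotBy r i))⁻¹ * f (rotBy r i) * u (rotBy r i) := by
  rw [mul_assoc, inv_mul_eq_iff_eq_mul, wreathBase_apply, wreathBase_apply, wreathBy_mul,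
    wreathBy_mul, ← rotBy_inv, ← rotBy_inv]
  simp [rotBy_zero, mul_assoc]

theorem extProd_comp_perm {ι H : Type*} [Fintype ι] (ψ : ι → H → ℂ) (δ : Equiv.Perm ι)
    (f : ι → H) : extProd (fun i => ψ (δ i)) (fun i => f (δ i)) = extProd ψ f :=
  Equiv.prod_comp δ fun i => ψ i (f i)

theorem extProd_comp_arrowCongr {ι H : Type*} [Fintype ι] (ψ : ι → H → ℂ) (δ : Equiv.Perm ι) :
    extProd ψ ∘ δ.arrowCongr (Equiv.refl H) = extProd fun i => ψ (δ i) := funext fun f => by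
  rw [Function.comp_apply, ← extProd_comp_perm ψ δ]
  simp

theorem indProd_comp_mulEquiv {φ : Syl p (k + 1) ≃* Syl p (k + 1)}
    {e : (Fin p → Syl p k) ≃ (Fin p → Syl p k)}
    (he : ∀ f, wreathBase p k (e f) = φ (wreathBase p k f)) {ϑ ϑ' : Fin p → Syl p k → ℂ}
    (hϑ : extProd ϑ ∘ e = extProd ϑ') : indProd ϑ ∘ φ = indProd ϑ' := by
  funext g
  rw [Function.comp_apply, indProd_eq, indProd_eq, indChar_equiv φ e he, hϑ]

theorem indProd_comp_rotBy (ϑ : Fin p → Syl p k → ℂ) (r : ZMod p) :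
    indProd (fun i => ϑ (rotBy r i)) = indProd ϑ := by
  let w : Syl p (k + 1) := wreathBy 1 r
  have he (f : Fin p → Syl p k) :
      wreathBase p k ((rotBy r).arrowCongr (Equiv.refl _) f) =
        MulAut.conj w (wreathBase p k f) := by
    rw [MulAut.conj_apply, eq_mul_inv_iff_mul_eq, ← inv_mul_eq_iff_eq_mul, ← mul_assoc,
      conj_wreathBase]
    simp
  rw [← indProd_comp_mulEquiv he (extProd_comp_arrowCongr ϑ (rotBy r))]
  funext g
  rw [Function.comp_apply, ← isClassFun_indProd _ w, MulAut.conj_apply]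
  group

theorem indProd_wreathBase {ϑ : Fin p → Syl p k → ℂ} (hϑ : ∀ i, IsClassFun (ϑ i))
    (f : Fin p → Syl p k) :
    indProd ϑ (wreathBase p k f) = ∑ r, extProd (fun i => ϑ (rotBy r i)) f := by
  classical
  have hterm (r : ZMod p) (u : Fin p → Syl p k) :
      ∑ h, (if wreathBase p k h = (wreathBy u r)⁻¹ * wreathBase p k f * wreathBy u r
        then extProd ϑ h else 0) = extProd (fun i => ϑ (rotBy (-r) i)) f := by
    simp only [conj_wreathBase, (wreathBase_injective p k).eq_iff, Finset.sum_ite_eq',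
      Finset.mem_univ, if_true]
    rw [← extProd_comp_perm _ (rotBy r) f]
    simp [extProd, hϑ _ _ _, ← rotBy_inv]
  rw [indProd_eq, indChar_apply, sum_syl_succ, ← Equiv.sum_comp (Equiv.neg (ZMod p)) fun r =>
    extProd (fun i => ϑ (rotBy r i)) f]
  simp [hterm, ← Finset.mul_sum]

open Classical in
theorem wInner_indProd {ϑ ϑ' : Fin p → Syl p k → ℂ} (hϑ : ∀ i, IsIrrChar (ϑ i))
    (hϑ' : ∀ i, IsIrrChar (ϑ' i)) :
    ⟪indProd ϑ, indProd ϑ'⟫ₙ_[ℂ] =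
      ∑ r : ZMod p, if ϑ = fun i => ϑ' (rotBy r i) then 1 else 0 := by
  have hres : indProd ϑ' ∘ wreathBase p k = ∑ r, extProd fun i => ϑ' (rotBy r i) := by
    funext f
    rw [Function.comp_apply, indProd_wreathBase fun i => (hϑ' i).isClassFun, Finset.sum_apply]
  rw [wInner_indProd_left _ (isClassFun_indProd _), hres]
  simp only [wInner_sum_right, wInner_extProd_of_isIrrChar hϑ fun _ => hϑ' _]

end InducedProducts

section TensorPowers

variable {p n : ℕ} {G : Type*} [Group G]

theorem tensorAct_tprod (ρ : Representation ℂ G (Fin n → ℂ)) (f : Fin p → G)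
    (δ : Equiv.Perm (Fin p)) (v : Fin p → Fin n → ℂ) :
    tensorAct ρ f δ (PiTensorProduct.tprod ℂ v) =
      PiTensorProduct.tprod ℂ fun i => ρ (f i) (v (δ⁻¹ i)) := by
  rw [tensorAct, LinearMap.comp_apply, LinearEquiv.coe_coe, PiTensorProduct.reindex_tprod,
    PiTensorProduct.map_tprod]
  rfl

theorem tensorAct_mul (ρ : Representation ℂ G (Fin n → ℂ)) (f f' : Fin p → G)
    (δ δ' : Equiv.Perm (Fin p)) :
    tensorAct ρ f δ * tensorAct ρ f' δ' =
      tensorAct ρ (fun m => f m * f' (δ⁻¹ m)) (δ * δ') :=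
  PiTensorProduct.ext (MultilinearMap.ext fun v => by simp [tensorAct_tprod])

theorem tensorAct_one (ρ : Representation ℂ G (Fin n → ℂ)) :
    tensorAct ρ (1 : Fin p → G) 1 = 1 :=
  PiTensorProduct.ext (MultilinearMap.ext fun v => by simp [tensorAct_tprod])

theorem trace_tensorAct_one (ρ : Representation ℂ G (Fin n → ℂ)) (f : Fin p → G) :
    LinearMap.trace ℂ _ (tensorAct ρ f 1) = ∏ i, ρ.character (f i) := by
  have hmap : tensorAct ρ f 1 = PiTensorProduct.map fun i => ρ (f i) :=
    PiTensorProduct.ext (MultilinearMap.ext fun v => by simp [tensorAct_tprod])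
  rw [hmap, trace_piTensorProduct_map]
  rfl

theorem trace_tensorAct_conj (ρ : Representation ℂ G (Fin n → ℂ)) (f : Fin p → G)
    (δ σ : Equiv.Perm (Fin p)) :
    LinearMap.trace ℂ _ (tensorAct ρ (fun m => f (σ m)) (σ⁻¹ * δ * σ)) =
      LinearMap.trace ℂ _ (tensorAct ρ f δ) := by
  have hconj : tensorAct ρ (fun m => f (σ m)) (σ⁻¹ * δ * σ) =
      tensorAct ρ 1 σ⁻¹ * (tensorAct ρ f δ * tensorAct ρ 1 σ) := by
    simp [tensorAct_mul, mul_assoc]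
  have hinv : tensorAct ρ 1 σ * tensorAct ρ 1 σ⁻¹ = 1 := by
    simp [tensorAct_mul, ← tensorAct_one ρ, Pi.one_def]
  rw [hconj, LinearMap.trace_mul_comm, mul_assoc, hinv, mul_one]

theorem trace_tensorAct_equiv {m : ℕ} {ρ : Representation ℂ G (Fin n → ℂ)}
    {σ : Representation ℂ G (Fin m → ℂ)} (e : ρ.Equiv σ) (f : Fin p → G)
    (δ : Equiv.Perm (Fin p)) :
    LinearMap.trace ℂ _ (tensorAct ρ f δ) = LinearMap.trace ℂ _ (tensorAct σ f δ) := by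
  let E : (⨂[ℂ] _ : Fin p, (Fin n → ℂ)) ≃ₗ[ℂ] ⨂[ℂ] _ : Fin p, (Fin m → ℂ) :=
    PiTensorProduct.congr fun _ => e.toLinearEquiv
  have he (g : G) (v : Fin n → ℂ) : e.toLinearEquiv (ρ g v) = σ g (e.toLinearEquiv v) :=
    e.toIntertwiningMap.isIntertwining _ _ g v
  have hconj : E.conj (tensorAct ρ f δ) = tensorAct σ f δ :=
    PiTensorProduct.ext (MultilinearMap.ext fun v => by
      simp only [LinearMap.compMultilinearMap_apply, LinearEquiv.conj_apply_apply, E,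
        PiTensorProduct.congr_symm_tprod, tensorAct_tprod, PiTensorProduct.congr_tprod, he,
        LinearEquiv.apply_symm_apply])
  rw [← hconj, LinearMap.trace_conj']

end TensorPowers

section ExtendedTensorPowers

open RCLike

variable {p : ℕ} [NeZero p] {k n : ℕ}

theorem omega_pow_eq_stdAddChar (m : ℕ) : omega p ^ m = ZMod.stdAddChar (m : ZMod p) := by
  rw [← Int.cast_natCast, ZMod.stdAddChar_coe, omega, ← Complex.exp_nat_mul]
  congr 1
  push_cast
  ring

/-- The representation affording `𝒳(φ; ε)`, where `ρ` affords `φ`. The label `ε` is a residue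
modulo `p`, through which `φ_ε` depends on it. -/
noncomputable def xRep (ρ : Representation ℂ (Syl p k) (Fin n → ℂ)) (ε : ZMod p) :
    Representation ℂ (Syl p (k + 1)) (⨂[ℂ] _ : Fin p, (Fin n → ℂ)) where
  toFun g := ZMod.stdAddChar (ε * ((wreathEquiv p k).symm g).2) •
    tensorAct ρ ((wreathEquiv p k).symm g).1 (rotBy ((wreathEquiv p k).symm g).2)
  map_one' := by
    simp [← wreathBy_one, ← wreathEquiv_apply, rotBy_zero, tensorAct_one]
  map_mul' g g' := by
    obtain ⟨⟨f, r⟩, rfl⟩ := (wreathEquiv p k).surjective g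
    obtain ⟨⟨f', r'⟩, rfl⟩ := (wreathEquiv p k).surjective g'
    rw [wreathEquiv_apply, wreathEquiv_apply, wreathBy_mul]
    simp only [← wreathEquiv_apply, Equiv.symm_apply_apply]
    rw [smul_mul_smul_comm, tensorAct_mul, rotBy_mul, rotBy_inv, mul_add, AddChar.map_add_eq_mul]

theorem character_xRep (ρ : Representation ℂ (Syl p k) (Fin n → ℂ)) (ε : ZMod p)
    (f : Fin p → Syl p k) (r : ZMod p) :
    (xRep ρ ε).character (wreathBy f r) =
      ZMod.stdAddChar (ε * r) * LinearMap.trace ℂ _ (tensorAct ρ f (rotBy r)) := by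
  simp only [Representation.character, xRep, MonoidHom.coe_mk, OneHom.coe_mk, ← wreathEquiv_apply,
    Equiv.symm_apply_apply, map_smul, smul_eq_mul]

theorem character_xRep_comp_wreathBase (ρ : Representation ℂ (Syl p k) (Fin n → ℂ))
    (ε : ZMod p) : (xRep ρ ε).character ∘ wreathBase p k = extProd fun _ => ρ.character := by
  funext f
  simp [wreathBase_apply, character_xRep, rotBy_zero, trace_tensorAct_one, extProd]

theorem isX_iff {φ : Syl p k → ℂ} {ε : Fin p} {θ : Syl p (k + 1) → ℂ} :
    IsX φ ε θ ↔ ∃ (n : ℕ) (ρ : Representation ℂ (Syl p k) (Fin n → ℂ)),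
      ρ.character = φ ∧ θ = (xRep ρ ((ε : ℕ) : ZMod p)).character := by
  refine exists_congr fun n => exists_congr fun ρ => and_congr_right fun _ => ⟨fun h => ?_, ?_⟩
  · funext g
    obtain ⟨f, r, rfl⟩ := exists_wreathBy g
    rw [character_xRep, ← ZMod.natCast_zmod_val r, ← wreath_eq_wreathBy, h, rot_pow_eq_rotBy,
      omega_pow_eq_stdAddChar, mul_comm, Nat.cast_mul]
  · rintro rfl f s
    rw [wreath_eq_wreathBy, character_xRep, rot_pow_eq_rotBy, omega_pow_eq_stdAddChar, mul_comm,
      Nat.cast_mul]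

theorem isX_character_iff {ρ : Representation ℂ (Syl p k) (Fin n → ℂ)} (hρ : ρ.IsIrreducible)
    {ε : Fin p} {θ : Syl p (k + 1) → ℂ} :
    IsX ρ.character ε θ ↔ θ = (xRep ρ ((ε : ℕ) : ZMod p)).character := by
  rw [isX_iff]
  refine ⟨?_, fun h => ⟨n, ρ, rfl, h⟩⟩
  rintro ⟨m, σ, hσ, rfl⟩
  obtain ⟨e⟩ := nonempty_equiv_of_character_eq hρ hσ.symm
  funext g
  obtain ⟨f, r, rfl⟩ := exists_wreathBy g
  rw [character_xRep, character_xRep, trace_tensorAct_equiv e]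

theorem indProd_wreathBy_of_ne_zero (ϑ : Fin p → Syl p k → ℂ) (f : Fin p → Syl p k) {r : ZMod p}
    (hr : r ≠ 0) : indProd ϑ (wreathBy f r) = 0 := by
  classical
  have hne (h : Fin p → Syl p k) (u : Syl p (k + 1)) :
      wreathBase p k h ≠ u⁻¹ * wreathBy f r * u := fun heq => by
    obtain ⟨u, s, rfl⟩ := exists_wreathBy u
    rw [wreathBase_apply, wreathBy_inv, wreathBy_mul, wreathBy_mul, wreathBy_inj] at heq
    exact hr (by simpa using heq.2.symm)
  rw [indProd_eq, indChar_apply]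
  simp [hne]

theorem sum_character_xRep (ρ : Representation ℂ (Syl p k) (Fin n → ℂ)) :
    ∑ ε, (xRep ρ ε).character = indProd fun _ => ρ.character := by
  funext g
  obtain ⟨f, r, rfl⟩ := exists_wreathBy g
  simp only [Finset.sum_apply, character_xRep, ← Finset.sum_mul,
    AddChar.sum_mulShift r (ZMod.isPrimitive_stdAddChar p)]
  obtain rfl | hr := eq_or_ne r 0
  · rw [← wreathBase_apply, indProd_wreathBase fun _ => isClassFun_character ρ]
    simp [rotBy_zero, trace_tensorAct_one, extProd, ZMod.card]
  · rw [indProd_wreathBy_of_ne_zero _ _ hr]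
    simp [hr]

theorem wInner_indProd_character_xRep (ϑ : Fin p → Syl p k → ℂ)
    (ρ : Representation ℂ (Syl p k) (Fin n → ℂ)) (ε : ZMod p) :
    ⟪indProd ϑ, (xRep ρ ε).character⟫ₙ_[ℂ] = ⟪extProd ϑ, extProd fun _ => ρ.character⟫ₙ_[ℂ] := by
  rw [wInner_indProd_left _ (isClassFun_character _), character_xRep_comp_wreathBase]

theorem wInner_character_xRep {ρ : Representation ℂ (Syl p k) (Fin n → ℂ)}
    (hρ : ρ.IsIrreducible) (ε ε' : ZMod p) :
    ⟪(xRep ρ ε).character, (xRep ρ ε').character⟫ₙ_[ℂ] = if ε = ε' then 1 else 0 := by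
  classical
  have hext : ⟪extProd fun _ : Fin p => ρ.character, extProd fun _ => ρ.character⟫ₙ_[ℂ] = 1 := by
    rw [wInner_extProd_of_isIrrChar, if_pos rfl] <;> exact fun _ => ⟨n, ρ, hρ, rfl⟩
  have hsum : ∑ ε', Module.finrank ℂ ((xRep ρ ε).IntertwiningMap (xRep ρ ε')) = 1 := by
    have : ∑ ε', ⟪(xRep ρ ε).character, (xRep ρ ε').character⟫ₙ_[ℂ] = 1 := by
      rw [← wInner_sum_right, sum_character_xRep, ← conj_wInner_symm,
        wInner_indProd_character_xRep, hext, map_one]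
    simp only [wInner_character] at this
    exact_mod_cast this
  have hself : Module.finrank ℂ ((xRep ρ ε).IntertwiningMap (xRep ρ ε)) ≠ 0 := fun h0 => by
    have hX : (xRep ρ ε).character = 0 :=
      eq_zero_of_wInner_self_re_nonpos (by rw [wInner_character, h0]; simp)
    rw [← character_xRep_comp_wreathBase ρ ε, hX] at hext
    simp [wInner] at hext
  have hnonneg (η : ZMod p) (_ : η ∈ Finset.univ) :
      0 ≤ Module.finrank ℂ ((xRep ρ ε).IntertwiningMap (xRep ρ η)) := Nat.zero_le _
  rw [wInner_character]
  split_ifs with h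
  · have := Finset.single_le_sum hnonneg (Finset.mem_univ ε)
    rw [← h, show Module.finrank ℂ _ = 1 by omega, Nat.cast_one]
  · have := Finset.add_le_sum hnonneg (Finset.mem_univ ε) (Finset.mem_univ ε') h
    rw [show Module.finrank ℂ _ = 0 by omega, Nat.cast_zero]

end ExtendedTensorPowers

section Classification

open RCLike

theorem natCast_fin_injective (p : ℕ) : Function.Injective fun ε : Fin p => ((ε : ℕ) : ZMod p) :=
  fun ε ε' h => Fin.ext (by
    rwa [ZMod.natCast_eq_natCast_iff', Nat.mod_eq_of_lt ε.2, Nat.mod_eq_of_lt ε'.2] at h)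

variable {p : ℕ} [NeZero p] {k : ℕ}

theorem IsX.comp_wreathBase {φ : Syl p k → ℂ} {ε : Fin p} {θ : Syl p (k + 1) → ℂ}
    (h : IsX φ ε θ) : θ ∘ wreathBase p k = extProd fun _ => φ := by
  obtain ⟨n, ρ, rfl, rfl⟩ := isX_iff.1 h
  exact character_xRep_comp_wreathBase ρ _

theorem IsX.isClassFun {φ : Syl p k → ℂ} {ε : Fin p} {θ : Syl p (k + 1) → ℂ} (h : IsX φ ε θ) :
    IsClassFun θ := by
  obtain ⟨n, ρ, rfl, rfl⟩ := isX_iff.1 h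
  exact isClassFun_character _

theorem IsX.eq_and_eq {φ φ' : Syl p k → ℂ} {ε ε' : Fin p} {θ : Syl p (k + 1) → ℂ}
    (hφ : IsIrrChar φ) (hφ' : IsIrrChar φ') (h : IsX φ ε θ) (h' : IsX φ' ε' θ) :
    φ = φ' ∧ ε = ε' := by
  obtain rfl : φ = φ' := congrFun (eq_of_extProd_eq (fun _ => hφ) (fun _ => hφ')
    (h.comp_wreathBase.symm.trans h'.comp_wreathBase)) 0
  obtain ⟨n, ρ, hρ, rfl⟩ := hφ
  rw [isX_character_iff hρ] at h h'
  have h1 := wInner_character_xRep hρ ((ε : ℕ) : ZMod p) ((ε' : ℕ) : ZMod p)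
  rw [← h', h, wInner_character_xRep hρ, if_pos rfl] at h1
  exact ⟨rfl, natCast_fin_injective p (by simpa using h1)⟩

theorem IsX.unique {φ : Syl p k → ℂ} {ε : Fin p} {θ θ' : Syl p (k + 1) → ℂ} (hφ : IsIrrChar φ)
    (h : IsX φ ε θ) (h' : IsX φ ε θ') : θ = θ' := by
  obtain ⟨n, ρ, hρ, rfl⟩ := hφ
  rw [isX_character_iff hρ] at h h'
  rw [h, h']

theorem exists_rotBy_of_indProd_eq {ϑ ϑ' : Fin p → Syl p k → ℂ} (hϑ : ∀ i, IsIrrChar (ϑ i))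
    (hϑ' : ∀ i, IsIrrChar (ϑ' i)) (h : indProd ϑ = indProd ϑ') :
    ∃ r, ϑ = fun i => ϑ' (rotBy r i) := by
  classical
  have h1 := wInner_indProd hϑ hϑ'
  rw [← h, wInner_indProd hϑ hϑ, Finset.sum_boole, Finset.sum_boole, Nat.cast_inj] at h1
  have hpos : 0 < Finset.card {r : ZMod p | ϑ = fun i => ϑ (rotBy r i)} :=
    Finset.card_pos.2 ⟨0, by simp [rotBy_zero]⟩
  obtain ⟨r, hr⟩ := Finset.card_pos.1 (h1 ▸ hpos)
  exact ⟨r, (Finset.mem_filter_univ r).1 hr⟩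

theorem IsIrrChar.exists_isX_of_wInner_ne_zero {θ : Syl p (k + 1) → ℂ} (hθ : IsIrrChar θ)
    {φ : Syl p k → ℂ} (hφ : IsIrrChar φ) (h : ⟪indProd fun _ => φ, θ⟫ₙ_[ℂ] ≠ 0) :
    ∃ ε, IsX φ ε θ := by
  obtain ⟨m, ρ, -, rfl⟩ := id hθ
  obtain ⟨n, σ, hσ, rfl⟩ := hφ
  rw [← sum_character_xRep, ← conj_wInner_symm, wInner_sum_right, Ne, map_eq_zero] at h
  obtain ⟨ε, -, hε⟩ := Finset.exists_ne_zero_of_sum_ne_zero h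
  rw [wInner_character, Nat.cast_ne_zero] at hε
  have hX := eq_of_wInner_eq_natCast hθ.wInner_self (by rw [wInner_character_xRep hσ, if_pos rfl])
    hε (wInner_character ρ (xRep σ ε))
  refine ⟨⟨ε.val, ε.val_lt⟩, (isX_character_iff hσ).2 ?_⟩
  rwa [ZMod.natCast_zmod_val]

section Prime

variable {p : ℕ} [Fact p.Prime] {k : ℕ}

theorem eq_of_eq_comp_rotBy {α : Type*} {F : Fin p → α} {r : ZMod p} (hr : r ≠ 0)
    (h : F = fun i => F (rotBy r i)) (i j : Fin p) : F i = F j := by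
  have hper : Function.Periodic (fun x => F ((residue p).symm x)) r := fun x => by
    change _ = F ((residue p).symm x)
    rw [congrFun h ((residue p).symm x)]
    simp [rotBy, Equiv.permCongr_apply]
  have hij := hper.nat_mul ((residue p j - residue p i) / r).val (residue p i)
  simpa [div_mul_cancel₀ _ hr] using hij.symm

theorem wInner_indProd_self {ϑ : Fin p → Syl p k → ℂ} (hϑ : ∀ i, IsIrrChar (ϑ i))
    (hne : ∃ i j, ϑ i ≠ ϑ j) : ⟪indProd ϑ, indProd ϑ⟫ₙ_[ℂ] = 1 := by
  classical
  obtain ⟨i, j, hij⟩ := hne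
  rw [wInner_indProd hϑ hϑ, Finset.sum_eq_single 0, if_pos (by simp [rotBy_zero])]
  · exact fun r _ hr => if_neg fun h => hij (eq_of_eq_comp_rotBy hr h i j)
  · simp

theorem not_isX_indProd {ϑ : Fin p → Syl p k → ℂ} (hϑ : ∀ i, IsIrrChar (ϑ i))
    (hne : ∃ i j, ϑ i ≠ ϑ j) {φ : Syl p k → ℂ} (hφ : IsIrrChar φ) (ε : Fin p) :
    ¬ IsX φ ε (indProd ϑ) := fun h => by
  have h1 := wInner_indProd_left ϑ h.isClassFun
  rw [wInner_indProd_self hϑ hne, h.comp_wreathBase, wInner_extProd_of_isIrrChar hϑ fun _ => hφ,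
    if_neg] at h1
  · exact one_ne_zero h1
  · rintro rfl
    obtain ⟨_, _, hij⟩ := hne
    exact hij rfl

theorem IsIrrChar.eq_indProd_of_wInner_ne_zero {θ : Syl p (k + 1) → ℂ} (hθ : IsIrrChar θ)
    {ψ : Fin p → Syl p k → ℂ} (hψ : ∀ i, IsIrrChar (ψ i)) (hne : ∃ i j, ψ i ≠ ψ j)
    (h : ⟪indProd ψ, θ⟫ₙ_[ℂ] ≠ 0) : θ = indProd ψ := by
  have hres := wInner_indProd_left ψ hθ.isClassFun
  obtain ⟨n, ρ, _, rfl⟩ := id hθ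
  obtain ⟨m, hm⟩ := exists_nat_wInner_extProd (ρ.comp (wreathBase p k)) hψ
  have hm' : ⟪indProd ψ, ρ.character⟫ₙ_[ℂ] = m := hres.trans hm
  refine (eq_of_wInner_eq_natCast (wInner_indProd_self hψ hne) hθ.wInner_self ?_ hm').symm
  rintro rfl
  exact h (by simpa using hm')

theorem IsIrrChar.exists_isX_or_eq_indProd {θ : Syl p (k + 1) → ℂ} (hθ : IsIrrChar θ) :
    (∃ (φ : Syl p k → ℂ) (ε : Fin p), IsIrrChar φ ∧ IsX φ ε θ) ∨
    ∃ ϑ : Fin p → Syl p k → ℂ, (∀ i, IsIrrChar (ϑ i)) ∧ (∃ i j, ϑ i ≠ ϑ j) ∧ θ = indProd ϑ := by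
  obtain ⟨ψ, hψ, hne⟩ := exists_wInner_extProd_ne_zero (α := θ ∘ wreathBase p k)
    (by simpa using hθ.apply_one_ne_zero)
  rw [← wInner_indProd_left ψ hθ.isClassFun] at hne
  by_cases hψne : ∃ i j, ψ i ≠ ψ j
  · exact Or.inr ⟨ψ, hψ, hψne, hθ.eq_indProd_of_wInner_ne_zero hψ hψne hne⟩
  · push Not at hψne
    obtain ⟨φ, rfl⟩ : ∃ φ, ψ = fun _ => φ := ⟨ψ 0, funext fun i => hψne i 0⟩
    obtain ⟨ε, hε⟩ := hθ.exists_isX_of_wInner_ne_zero (hψ 0) hne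
    exact Or.inl ⟨φ, ε, hψ 0, hε⟩

end Prime

end Classification

section Conjugation

theorem IsIrrChar.comp {G H : Type*} [Group G] [Group H] {χ : G → ℂ} (hχ : IsIrrChar χ)
    {i : H →* G} (hi : Function.Surjective i) : IsIrrChar (χ ∘ i) := by
  obtain ⟨n, ρ, hρ, rfl⟩ := hχ
  let ρ' : Representation ℂ H (Fin n → ℂ) := (ρ : _ →* _).comp i
  let pullback : Subrepresentation ρ ≃o Subrepresentation ρ' :=
    { toFun := fun N => ⟨N.toSubmodule, fun g => N.apply_mem_toSubmodule (i g)⟩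
      invFun := fun N => ⟨N.toSubmodule, fun g => by
        obtain ⟨x, rfl⟩ := hi g
        exact N.apply_mem_toSubmodule x⟩
      left_inv := fun _ => rfl
      right_inv := fun _ => rfl
      map_rel_iff' := Iff.rfl }
  exact ⟨n, ρ', (OrderIso.isSimpleOrder_iff pullback).1 hρ, rfl⟩

variable {p : ℕ} [NeZero p] {k : ℕ}

/-- The automorphism `g ↦ h⁻¹ g h` of `P_{p ^ k}` for `h ∈ N_{p ^ k}`, so that `θ ^ h` is `θ`
composed with it. -/
def conjEquiv (h : Nor p k) : Syl p k ≃* Syl p k := (Syl p k).normalizerMonoidHom h⁻¹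

theorem coe_conjEquiv (h : Nor p k) (g : Syl p k) :
    (conjEquiv h g : Equiv.Perm (Fin (p ^ k))) = (h : Equiv.Perm (Fin (p ^ k)))⁻¹ * g * h := by
  simp [conjEquiv]

theorem conjChar_eq_comp (h : Nor p k) (θ : Syl p k → ℂ) : conjChar h θ = θ ∘ conjEquiv h :=
  funext fun g => congrArg θ (Subtype.ext (coe_conjEquiv h g).symm)

theorem IsIrrChar.conjChar {θ : Syl p k → ℂ} (hθ : IsIrrChar θ) (h : Nor p k) :
    IsIrrChar (conjChar h θ) := by
  rw [conjChar_eq_comp]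
  exact hθ.comp (i := (conjEquiv h).toMonoidHom) (conjEquiv h).surjective

theorem conjChar_injective (h : Nor p k) : Function.Injective (conjChar h) := fun θ θ' e =>
  (conjEquiv h).surjective.injective_comp_right (by simpa only [conjChar_eq_comp] using e)

theorem coe_sigmaN_castSucc (a : (ZMod p)ˣ) (j : Fin k) :
    (sigmaN a (k + 1) j.castSucc : Equiv.Perm (Fin (p ^ (k + 1)))) =
      wr (fun _ => (sigmaN a k j : Equiv.Perm (Fin (p ^ k)))) 1 := by
  simp [sigmaN, sigma]

theorem coe_sigmaN_last (a : (ZMod p)ˣ) :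
    (sigmaN a (k + 1) (Fin.last k) : Equiv.Perm (Fin (p ^ (k + 1)))) = wr 1 (sigmaOne a) := by
  simp [sigmaN, sigma]

theorem conjEquiv_sigmaN_castSucc (a : (ZMod p)ˣ) (j : Fin k) (f : Fin p → Syl p k)
    (r : ZMod p) :
    conjEquiv (sigmaN a (k + 1) j.castSucc) (wreathBy f r) =
      wreathBy (fun i => conjEquiv (sigmaN a k j) (f i)) r := by
  apply Subtype.ext
  rw [coe_conjEquiv, coe_sigmaN_castSucc, coe_wreathBy, coe_wreathBy, mul_assoc,
    inv_mul_eq_iff_eq_mul, wr_mul, wr_mul]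
  simp [coe_conjEquiv, mul_assoc]

theorem conjEquiv_sigmaN_last (a : (ZMod p)ˣ) (f : Fin p → Syl p k) (r : ZMod p) :
    conjEquiv (sigmaN a (k + 1) (Fin.last k)) (wreathBy f r) =
      wreathBy (fun i => f (sigmaOne a i)) (((a⁻¹ : (ZMod p)ˣ) : ZMod p) * r) := by
  apply Subtype.ext
  rw [coe_conjEquiv, coe_sigmaN_last, coe_wreathBy, coe_wreathBy, mul_assoc,
    inv_mul_eq_iff_eq_mul, wr_mul, wr_mul, sigmaOne_mul_rotBy, Units.mul_inv_cancel_left]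
  simp

theorem conjChar_castSucc_indProd (a : (ZMod p)ˣ) (j : Fin k) (ϑ : Fin p → Syl p k → ℂ) :
    conjChar (sigmaN a (k + 1) j.castSucc) (indProd ϑ) =
      indProd fun i => conjChar (sigmaN a k j) (ϑ i) := by
  rw [conjChar_eq_comp]
  refine indProd_comp_mulEquiv (e := Equiv.piCongrRight fun _ => (conjEquiv (sigmaN a k j)).toEquiv)
    (fun f => (conjEquiv_sigmaN_castSucc a j f 0).symm) ?_
  simp only [conjChar_eq_comp]
  rfl

theorem conjChar_last_indProd (a : (ZMod p)ˣ) (ϑ : Fin p → Syl p k → ℂ) :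
    conjChar (sigmaN a (k + 1) (Fin.last k)) (indProd ϑ) = indProd fun i => ϑ (tau a i) := by
  rw [conjChar_eq_comp]
  refine indProd_comp_mulEquiv (fun f => ?_) (extProd_comp_arrowCongr ϑ (tau a))
  rw [wreathBase_apply, wreathBase_apply, conjEquiv_sigmaN_last, mul_zero]
  rfl

theorem IsX.conjChar_castSucc {φ : Syl p k → ℂ} {ε : Fin p} {θ : Syl p (k + 1) → ℂ}
    (h : IsX φ ε θ) (a : (ZMod p)ˣ) (j : Fin k) :
    IsX (conjChar (sigmaN a k j) φ) ε (conjChar (sigmaN a (k + 1) j.castSucc) θ) := by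
  obtain ⟨n, ρ, rfl, h⟩ := h
  refine ⟨n, (ρ : _ →* _).comp (conjEquiv (sigmaN a k j)).toMonoidHom, ?_, fun f s => ?_⟩
  · rw [conjChar_eq_comp]
    rfl
  · rw [conjChar_eq_comp, Function.comp_apply, wreath_eq_wreathBy, conjEquiv_sigmaN_castSucc,
      ← wreath_eq_wreathBy, h]
    rfl

theorem IsX.conjChar_last {φ : Syl p k → ℂ} {ε ε' : Fin p} {θ : Syl p (k + 1) → ℂ}
    (h : IsX φ ε θ) (a : (ZMod p)ˣ)
    (hε : ((ε' : ℕ) : ZMod p) = (a⁻¹ : (ZMod p)ˣ) * ((ε : ℕ) : ZMod p)) :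
    IsX φ ε' (conjChar (sigmaN a (k + 1) (Fin.last k)) θ) := by
  obtain ⟨n, ρ, hφ, rfl⟩ := isX_iff.1 h
  refine isX_iff.2 ⟨n, ρ, hφ, funext fun g => ?_⟩
  obtain ⟨f, r, rfl⟩ := exists_wreathBy g
  have hrot : (sigmaOne a)⁻¹ * rotBy r * sigmaOne a =
      rotBy (((a⁻¹ : (ZMod p)ˣ) : ZMod p) * r) := by
    rw [mul_assoc, inv_mul_eq_iff_eq_mul, sigmaOne_mul_rotBy, Units.mul_inv_cancel_left]
  rw [conjChar_eq_comp, Function.comp_apply, conjEquiv_sigmaN_last, character_xRep,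
    character_xRep, hε, ← hrot, trace_tensorAct_conj, mul_left_comm, mul_assoc]

end Conjugation

section TreeFunctions

variable {p : ℕ} [NeZero p] {k : ℕ}

theorem mk_eq_mk_iff {t t' : LabelFn p (k + 1)} :
    TreeFn.mk t = TreeFn.mk t' ↔
      t.root = t'.root ∧ ∃ r, ∀ i, TreeFn.mk (t.sub i) = TreeFn.mk (t'.sub (rotBy r i)) := by
  have hmk : ∀ {k : ℕ} {u u' : LabelFn p k}, TreeFn.mk u = TreeFn.mk u' ↔
      ∃ γ : List (Fin p) → Equiv.Perm (Fin p), (∀ q, γ q ∈ Subgroup.zpowers (rot p)) ∧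
        ∀ s : Skel p k, u s = u' ⟨relabel γ s, by rw [relabel_length]; exact s.2⟩ :=
    Quotient.eq
  simp only [hmk]
  constructor
  · rintro ⟨γ, hγ, h⟩
    obtain ⟨r, hr⟩ := mem_zpowers_rot_iff.1 (hγ [])
    exact ⟨h ⟨[], Nat.succ_pos k⟩, r, fun i => ⟨fun q => γ (i :: q), fun q => hγ _,
      fun s => hr ▸ h ⟨i :: s.1, Nat.succ_lt_succ s.2⟩⟩⟩
  · rintro ⟨hroot, r, h⟩
    choose γ hγ h using h
    refine ⟨fun q => List.casesOn q (rotBy r) γ, ?_, ?_⟩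
    · rintro (_ | ⟨i, q⟩)
      · exact mem_zpowers_rot_iff.2 ⟨r, rfl⟩
      · exact hγ i q
    · rintro ⟨_ | ⟨i, s⟩, hs⟩
      · exact hroot
      · exact h i ⟨s, Nat.lt_of_succ_lt_succ hs⟩

theorem node_eq_node_iff {T T' : Fin p → TreeFn p k} {x x' : Fin (p + 1)} :
    TreeFn.node T x = TreeFn.node T' x' ↔ x = x' ∧ ∃ r, ∀ i, T i = T' (rotBy r i) := by
  have hsub (T : Fin p → TreeFn p k) (x : Fin (p + 1)) (i : Fin p) :
      TreeFn.mk (LabelFn.sub (LabelFn.node (fun i => Quotient.out (T i)) x) i) = T i :=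
    Quotient.out_eq (T i)
  rw [TreeFn.node, TreeFn.node, mk_eq_mk_iff]
  simp only [hsub]
  rfl

theorem node_mk_sub (t : LabelFn p (k + 1)) :
    TreeFn.node (fun i => TreeFn.mk (t.sub i)) t.root = TreeFn.mk t :=
  mk_eq_mk_iff.2 ⟨rfl, 0, fun i => by
    rw [rotBy_zero]
    exact Quotient.out_eq (TreeFn.mk (t.sub i))⟩

theorem subsingleton_treeFn_zero : Subsingleton (TreeFn p 0) :=
  ⟨fun T T' => Quotient.inductionOn₂ T T' fun _ _ =>
    congrArg TreeFn.mk (funext fun s => absurd s.2 (Nat.not_lt_zero _))⟩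

theorem admissible_succ_iff {t : LabelFn p (k + 1)} :
    t.Admissible ↔ (∀ i, (t.sub i).Admissible) ∧
      (t.root ≠ Fin.last p → ∀ i j, TreeFn.mk (t.sub i) = TreeFn.mk (t.sub j)) ∧
      (t.root = Fin.last p → ∃ i j, TreeFn.mk (t.sub i) ≠ TreeFn.mk (t.sub j)) := by
  cases k with
  | zero =>
    have hsub (i j : Fin p) : TreeFn.mk (t.sub i) = TreeFn.mk (t.sub j) :=
      subsingleton_treeFn_zero.elim _ _
    exact ⟨fun h => ⟨fun _ => trivial, fun _ => hsub, fun hx => absurd hx h⟩,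
      fun ⟨_, _, hne⟩ hx => let ⟨i, j, hij⟩ := hne hx; hij (hsub i j)⟩
  | succ k => exact Iff.rfl

theorem admissible_node_iff {T : Fin p → TreeFn p k} {x : Fin (p + 1)} :
    (TreeFn.node T x).Admissible ↔ (∀ i, (T i).Admissible) ∧
      (x ≠ Fin.last p → ∀ i j, T i = T j) ∧ (x = Fin.last p → ∃ i j, T i ≠ T j) := by
  constructor
  · rintro ⟨t, ht, hadm⟩
    obtain ⟨hsub, heq, hne⟩ := admissible_succ_iff.1 hadm
    obtain ⟨rfl, r, hr⟩ := node_eq_node_iff.1 ((node_mk_sub t).trans ht)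
    have hrot := (rotBy r).surjective
    exact ⟨hrot.forall.2 fun i => ⟨_, hr i, hsub i⟩,
      fun hx => hrot.forall₂.2 (by simpa only [hr] using heq hx),
      fun hx => hrot.exists₂.2 (by simpa only [hr] using hne hx)⟩
  · rintro ⟨hT, h⟩
    choose t ht hadm using hT
    obtain rfl : (fun i => TreeFn.mk (t i)) = T := funext ht
    exact ⟨LabelFn.node t x, (node_mk_sub _).symm, admissible_succ_iff.2 ⟨hadm, h⟩⟩

theorem node_comp_congr {T T' : Fin p → TreeFn p k} {x x' : Fin (p + 1)}
    (h : TreeFn.node T x = TreeFn.node T' x') (F : TreeFn p k → TreeFn p k) :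
    TreeFn.node (F ∘ T) x = TreeFn.node (F ∘ T') x' := by
  obtain ⟨rfl, r, hr⟩ := node_eq_node_iff.1 h
  exact node_eq_node_iff.2 ⟨rfl, r, fun i => congrArg F (hr i)⟩

theorem node_comp_tau_congr {T T' : Fin p → TreeFn p k} {x x' : Fin (p + 1)}
    (h : TreeFn.node T x = TreeFn.node T' x') (a : (ZMod p)ˣ) :
    TreeFn.node (T ∘ tau a) (tauLabel a x) = TreeFn.node (T' ∘ tau a) (tauLabel a x') := by
  obtain ⟨rfl, r, hr⟩ := node_eq_node_iff.1 h
  refine node_eq_node_iff.2 ⟨rfl, a * r, fun i => ?_⟩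
  have hrot : rotBy r * tau a = tau a * rotBy ((a : ZMod p) * r) := by
    rw [tau, eq_inv_mul_iff_mul_eq, ← mul_assoc, mul_inv_eq_iff_eq_mul, sigmaOne_mul_rotBy]
  exact (hr _).trans (congrArg T' (Equiv.congr_fun hrot i))

end TreeFunctions

section TauLabel

variable {p : ℕ} [NeZero p]

theorem residue_eq_natCast_succ (i : Fin p) : residue p i = ((i.succ : ℕ) : ZMod p) := by
  have hcast : (ZMod.finEquiv p i : ZMod p) = ((i : ℕ) : ZMod p) := by
    obtain ⟨n, rfl⟩ := Nat.exists_eq_succ_of_ne_zero (NeZero.ne p)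
    exact (Fin.cast_val_eq_self i).symm
  simp [residue, hcast]

theorem natCast_tauLabel (a : (ZMod p)ˣ) (x : Fin (p + 1)) :
    ((tauLabel a x : ℕ) : ZMod p) = (a⁻¹ : (ZMod p)ˣ) * ((x : ℕ) : ZMod p) := by
  induction x using Fin.cases with
  | zero => simp [tauLabel]
  | succ i =>
    rw [← residue_eq_natCast_succ, tauLabel, Fin.cases_succ, ← residue_eq_natCast_succ,
      Units.eq_inv_mul_iff_mul_eq, ← residue_sigmaOne, tau, Equiv.Perm.coe_inv,
      Equiv.apply_symm_apply]

theorem eq_last_iff {x : Fin (p + 1)} : x = Fin.last p ↔ x ≠ 0 ∧ ((x : ℕ) : ZMod p) = 0 := by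
  rw [ZMod.natCast_eq_zero_iff, Fin.ext_iff, Fin.val_last, ← Fin.val_ne_zero_iff]
  constructor
  · intro h
    rw [h]
    exact ⟨NeZero.ne p, dvd_rfl⟩
  · rintro ⟨h0, hdvd⟩
    exact le_antisymm x.is_le (Nat.le_of_dvd (Nat.pos_of_ne_zero h0) hdvd)

theorem tauLabel_eq_zero_iff {a : (ZMod p)ˣ} {x : Fin (p + 1)} : tauLabel a x = 0 ↔ x = 0 := by
  induction x using Fin.cases with
  | zero => exact iff_of_true rfl rfl
  | succ i => exact iff_of_false (Fin.succ_ne_zero _) (Fin.succ_ne_zero _)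

theorem tauLabel_eq_last_iff {a : (ZMod p)ˣ} {x : Fin (p + 1)} :
    tauLabel a x = Fin.last p ↔ x = Fin.last p := by
  rw [eq_last_iff, eq_last_iff, Ne, tauLabel_eq_zero_iff, natCast_tauLabel,
    Units.mul_right_eq_zero]

end TauLabel

section TreeOf

variable {p : ℕ} {k : ℕ}

theorem treeOf_of_isX [NeZero p] {φ : Syl p k → ℂ} {ε : Fin p} {θ : Syl p (k + 1) → ℂ}
    (hφ : IsIrrChar φ) (h : IsX φ ε θ) :
    treeOf θ = TreeFn.node (fun _ => treeOf φ) ε.castSucc := by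
  have hex : ∃ φε : (Syl p k → ℂ) × Fin p, IsIrrChar φε.1 ∧ IsX φε.1 φε.2 θ := ⟨(φ, ε), hφ, h⟩
  obtain ⟨hφ', hε'⟩ := hex.choose_spec.2.eq_and_eq hex.choose_spec.1 hφ h
  rw [treeOf, dif_pos hex, hφ', hε']

variable [Fact p.Prime]

theorem treeOf_indProd {ϑ : Fin p → Syl p k → ℂ} (hϑ : ∀ i, IsIrrChar (ϑ i))
    (hne : ∃ i j, ϑ i ≠ ϑ j) :
    treeOf (indProd ϑ) = TreeFn.node (fun i => treeOf (ϑ i)) (Fin.last p) := by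
  have hex : ∃ ϑ' : Fin p → Syl p k → ℂ,
      (∀ i, IsIrrChar (ϑ' i)) ∧ (∃ i j, ϑ' i ≠ ϑ' j) ∧ indProd ϑ = indProd ϑ' :=
    ⟨ϑ, hϑ, hne, rfl⟩
  obtain ⟨hϑ', -, heq⟩ := hex.choose_spec
  obtain ⟨r, hr⟩ := exists_rotBy_of_indProd_eq hϑ' hϑ heq.symm
  rw [treeOf, dif_neg fun ⟨_, hφ, hX⟩ => not_isX_indProd hϑ hne hφ _ hX, dif_pos hex,
    node_eq_node_iff]
  exact ⟨rfl, r, fun i => congrArg treeOf (congrFun hr i)⟩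

theorem treeOf_injective : ∀ {k : ℕ} {θ θ' : Syl p k → ℂ}, IsIrrChar θ → IsIrrChar θ' →
    treeOf θ = treeOf θ' → θ = θ'
  | 0, _, _, hθ, hθ', _ =>
    have : Subsingleton (Fin (p ^ 0)) := by rw [pow_zero]; infer_instance
    hθ.eq_of_subsingleton hθ'
  | k + 1, θ, θ', hθ, hθ', h => by
    rcases hθ.exists_isX_or_eq_indProd with ⟨φ, ε, hφ, hX⟩ | ⟨ϑ, hϑ, hne, rfl⟩ <;>
    rcases hθ'.exists_isX_or_eq_indProd with ⟨φ', ε', hφ', hX'⟩ | ⟨ϑ', hϑ', hne', rfl⟩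
    · rw [treeOf_of_isX hφ hX, treeOf_of_isX hφ' hX', node_eq_node_iff] at h
      obtain ⟨hε, _, h⟩ := h
      obtain rfl := Fin.castSucc_injective _ hε
      obtain rfl := treeOf_injective hφ hφ' (h 0)
      exact hX.unique hφ hX'
    · rw [treeOf_of_isX hφ hX, treeOf_indProd hϑ' hne', node_eq_node_iff] at h
      exact absurd h.1 (Fin.castSucc_lt_last ε).ne
    · rw [treeOf_indProd hϑ hne, treeOf_of_isX hφ' hX', node_eq_node_iff] at h
      exact absurd h.1.symm (Fin.castSucc_lt_last ε').ne
    · rw [treeOf_indProd hϑ hne, treeOf_indProd hϑ' hne', node_eq_node_iff] at h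
      obtain ⟨-, r, h⟩ := h
      obtain rfl : ϑ = fun i => ϑ' (rotBy r i) :=
        funext fun i => treeOf_injective (hϑ i) (hϑ' _) (h i)
      exact indProd_comp_rotBy ϑ' r

theorem treeAct_treeOf {θ : Syl p k → ℂ} (hθ : IsIrrChar θ) (h : Nor p k) :
    treeAct h (treeOf θ) = treeOf (conjChar h θ) := by
  have hex : ∃ θ' : Syl p k → ℂ, IsIrrChar θ' ∧ treeOf θ' = treeOf θ := ⟨θ, hθ, rfl⟩
  rw [treeAct, dif_pos hex, treeOf_injective hex.choose_spec.1 hθ hex.choose_spec.2]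

theorem admissible_treeOf : ∀ {k : ℕ} {θ : Syl p k → ℂ}, IsIrrChar θ → (treeOf θ).Admissible
  | 0, _, _ => ⟨fun _ => 0, by rw [treeOf], trivial⟩
  | k + 1, θ, hθ => by
    rcases hθ.exists_isX_or_eq_indProd with ⟨φ, ε, hφ, hX⟩ | ⟨ϑ, hϑ, ⟨i, j, hij⟩, rfl⟩
    · rw [treeOf_of_isX hφ hX]
      exact admissible_node_iff.2 ⟨fun _ => admissible_treeOf hφ, fun _ _ _ => rfl,
        fun h => absurd h (Fin.castSucc_lt_last ε).ne⟩
    · rw [treeOf_indProd hϑ ⟨i, j, hij⟩]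
      exact admissible_node_iff.2 ⟨fun i => admissible_treeOf (hϑ i), fun h => absurd rfl h,
        fun _ => ⟨i, j, fun h => hij (treeOf_injective (hϑ i) (hϑ j) h)⟩⟩

theorem treeOf_conjChar_castSucc {θ : Syl p (k + 1) → ℂ} (hθ : IsIrrChar θ)
    {T : Fin p → TreeFn p k} {x : Fin (p + 1)} (hT : treeOf θ = TreeFn.node T x)
    (a : (ZMod p)ˣ) (j : Fin k) :
    treeOf (conjChar (sigmaN a (k + 1) j.castSucc) θ) =
      TreeFn.node (fun i => treeAct (sigmaN a k j) (T i)) x := by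
  rcases hθ.exists_isX_or_eq_indProd with ⟨φ, ε, hφ, hX⟩ | ⟨ϑ, hϑ, ⟨i, i', hne⟩, rfl⟩
  · rw [treeOf_of_isX hφ hX] at hT
    rw [treeOf_of_isX (hφ.conjChar _) (hX.conjChar_castSucc a j), ← treeAct_treeOf hφ]
    exact node_comp_congr hT (treeAct (sigmaN a k j))
  · rw [treeOf_indProd hϑ ⟨i, i', hne⟩] at hT
    rw [conjChar_castSucc_indProd, treeOf_indProd (fun i => (hϑ i).conjChar _)
      ⟨i, i', (conjChar_injective _).ne hne⟩]
    simp only [← treeAct_treeOf (hϑ _)]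
    exact node_comp_congr hT (treeAct (sigmaN a k j))

theorem treeOf_conjChar_last {θ : Syl p (k + 1) → ℂ} (hθ : IsIrrChar θ)
    {T : Fin p → TreeFn p k} {x : Fin (p + 1)} (hT : treeOf θ = TreeFn.node T x)
    (a : (ZMod p)ˣ) :
    treeOf (conjChar (sigmaN a (k + 1) (Fin.last k)) θ) =
      TreeFn.node (fun i => T (tau a i)) (tauLabel a x) := by
  rcases hθ.exists_isX_or_eq_indProd with ⟨φ, ε, hφ, hX⟩ | ⟨ϑ, hϑ, ⟨i, j, hne⟩, rfl⟩
  · rw [treeOf_of_isX hφ hX] at hT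
    obtain ⟨ε', hε'⟩ : ∃ ε' : Fin p, ε'.castSucc = tauLabel a ε.castSucc :=
      Fin.exists_castSucc_eq.2 (tauLabel_eq_last_iff.not.2 (Fin.castSucc_lt_last ε).ne)
    have hlabel := natCast_tauLabel a ε.castSucc
    rw [← hε'] at hlabel
    rw [treeOf_of_isX hφ (hX.conjChar_last a hlabel), hε']
    exact node_comp_tau_congr hT a
  · rw [treeOf_indProd hϑ ⟨i, j, hne⟩] at hT
    rw [conjChar_last_indProd, treeOf_indProd (fun i => hϑ _)
      ⟨(tau a)⁻¹ i, (tau a)⁻¹ j, by simpa using hne⟩, ← tauLabel_eq_last_iff.2 rfl]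
    exact node_comp_tau_congr hT a

end TreeOf

end SylowTree

theorem theorem1_general (p : ℕ) [Fact p.Prime] (a : (ZMod p)ˣ)
    (k : ℕ) (θ : Syl p (k + 1) → ℂ) (hθ : IsIrrChar θ)
    (T : Fin p → TreeFn p k) (x : Fin (p + 1)) (hT : treeOf θ = TreeFn.node T x) :
    (treeOf θ).Admissible ∧ (∀ i, (T i).Admissible) ∧
    (∀ h : Nor p (k + 1), treeAct h (treeOf θ) = treeOf (conjChar h θ)) ∧
    (∀ j : Fin k, treeAct (sigmaN a (k + 1) j.castSucc) (treeOf θ) =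
      TreeFn.node (fun i => treeAct (sigmaN a k j) (T i)) x) ∧
    treeAct (sigmaN a (k + 1) (Fin.last k)) (treeOf θ) =
      TreeFn.node (fun i => T (tau a i)) (tauLabel a x) := by
  have hadm : (treeOf θ).Admissible := admissible_treeOf hθ
  have hact := treeAct_treeOf hθ
  refine ⟨hadm, (admissible_node_iff.1 (hT ▸ hadm)).1, hact, fun j => ?_, ?_⟩
  · rw [hact, treeOf_conjChar_castSucc hθ hT]
  · rw [hact, treeOf_conjChar_last hθ hT]

theorem theorem1 (p : ℕ) [Fact p.Prime]
    (a : (ZMod p)ˣ) (ha : ∀ c : (ZMod p)ˣ, c ∈ Subgroup.zpowers a)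
    (k : ℕ) (θ : Syl p (k + 1) → ℂ) (hθ : IsIrrChar θ)
    (T : Fin p → TreeFn p k) (x : Fin (p + 1)) (hT : treeOf θ = TreeFn.node T x) :
    (treeOf θ).Admissible ∧ (∀ i, (T i).Admissible) ∧
    (∀ h : Nor p (k + 1), treeAct h (treeOf θ) = treeOf (conjChar h θ)) ∧
    (∀ j : Fin k, treeAct (sigmaN a (k + 1) j.castSucc) (treeOf θ) =
      TreeFn.node (fun i => treeAct (sigmaN a k j) (T i)) x) ∧
    treeAct (sigmaN a (k + 1) (Fin.last k)) (treeOf θ) =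
      TreeFn.node (fun i => T (tau a i)) (tauLabel a x) :=
  theorem1_general p a k θ hθ T x hT
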